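/- For $v=(v_1,v_2)\in\mathbb R^2$ put $v^\perp=(-v_2,v_1)$. Norms on vectors are Euclidean, norms of matrices are the corresponding operator norms. Let $E:[0,\infty)\times\mathbb R^2\to\mathbb R^2$; Sobolev spaces $W^{k,\infty}$ and $L^\infty$ norms are taken over $(0,\infty)\times\mathbb R^2$ (in time and space), elements of $W^{k,\infty}$, $k\ge1$, are identified with their continuous representatives on $[0,\infty)\times\mathbb R^2$, and $K_x:=\|D_xE\|_{L^\infty}$. For $\varepsilon>0$ and $(x^0,v^0)\in\mathbb R^2\times\mathbb R^2$ let $(x_\varepsilon,v_\varepsilon)$ be the solution on $[0,\infty)$ of $$\varepsilon x_\varepsilon'(t)=v_\varepsilon(t),\qquad \varepsilon v_\varepsilon'(t)=E(t,x_\varepsilon(t))-\frac{v_\varepsilon^\perp(t)}{\varepsilon},\qquad x_\varepsilon(0)=x^0,\quad v_\varepsilon(0)=v^0.$$ For $\Delta t>0$ and $t_n=n\Delta t$ consider the first-order scheme (implicit in the velocity, explicit in $E$), for $n\ge0$, $$\frac{x_\varepsilon^{n+1}-x_\varepsilon^n}{\Delta t}=\frac{v_\varepsilon^{n+1}}{\varepsilon},\qquad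 \varepsilon\,\frac{v_\varepsilon^{n+1}-v_\varepsilon^n}{\Delta t}=E(t_n,x_\varepsilon^n)-\frac{(v_\varepsilon^{n+1})^\perp}{\varepsilon},\qquad x_\varepsilon^0=x^0,\quad v_\varepsilon^0=v^0,$$ and set $y_\varepsilon(t)=x_\varepsilon(t)-\varepsilon v_\varepsilon^\perp(t)$, $y_\varepsilon^n=x_\varepsilon^n-\varepsilon (v_\varepsilon^n)^\perp$. **Theorem.** For all $\varepsilon>0$, $\Delta t>0$ and $(x^0,v^0)$ the scheme has a unique solution $(x_\varepsilon^n,v_\varepsilon^n)_{n\ge0}$. Moreover: (i) If $E\in W^{1,\infty}$, there is a constant $C$ depending only on $E$ such that for all $n\ge0$, $\Delta t>0$, $\varepsilon>0$ and all $(x^0,v^0)$, $$\|x_\varepsilon^n-x_\varepsilon(t_n)\|\le C\,(1+t_n^2)\,e^{2K_xt_n}\,(1+\|v^0\|+\varepsilon)\,\min\Big(\frac{\Delta t}{\varepsilon^3}(1+\varepsilon^2),\ \Delta t+\varepsilon\Big).$$ (ii) If $E\in W^{2,\infty}$, there is a constant $C$ depending only on $E$ such that for all $n\ge0$, $\Delta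 t>0$, $\varepsilon>0$ and all $(x^0,v^0)$, $$\|y_\varepsilon^n-y_\varepsilon(t_n)\|\le C\,(1+t_n^4)\,e^{2K_xt_n}\,(1+\|v^0\|^2+\varepsilon^2)\,\min\Big(\frac{\Delta t}{\varepsilon^3}(1+\varepsilon),\ \Delta t+\varepsilon^2\Big).$$ -/

import Mathlib

open MeasureTheory Set

noncomputable section

namespace Sobolev

variable {G F : Type*} [NormedAddCommGroup G] [NormedSpace ℝ G] [MeasureSpace G]
  [NormedAddCommGroup F] [NormedSpace ℝ F]

/-- `g` is a weak (distributional) total derivative of `f` on the open set `Ω`: both are locally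
integrable on `Ω`, and `∫ (∂_w φ) f = - ∫ φ (g w)` for every direction `w` and every smooth
compactly supported test function `φ` with support in `Ω`. -/
structure HasWeakFDerivOn (Ω : Set G) (f : G → F) (g : G → (G →L[ℝ] F)) : Prop where
  locallyIntegrableOn : LocallyIntegrableOn f Ω volume
  locallyIntegrableOn_deriv : LocallyIntegrableOn g Ω volume
  integral_eq : ∀ φ : G → ℝ, ContDiff ℝ (⊤ : ℕ∞) φ → HasCompactSupport φ → tsupport φ ⊆ Ω →
    ∀ w : G, ∫ p, (fderiv ℝ φ p w) • f p = - ∫ p, φ p • g p w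

open Classical in
/-- The weak total derivative of `f` on `Ω` (unique up to a null set of `Ω`); zero if there is
none. -/
def weakFDeriv (Ω : Set G) (f : G → F) : G → (G →L[ℝ] F) :=
  if h : ∃ g, HasWeakFDerivOn Ω f g then h.choose else 0

/-- The Sobolev space `W^{1,∞}(Ω)`: functions in `L^∞(Ω)` which have a weak derivative, itself
in `L^∞(Ω)`. -/
structure MemW1Inf (Ω : Set G) (f : G → F) : Prop where
  memLp : MemLp f ⊤ (volume.restrict Ω)
  exists_weakFDeriv : ∃ g, HasWeakFDerivOn Ω f g
  memLp_weakFDeriv : MemLp (weakFDeriv Ω f) ⊤ (volume.restrict Ω)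

/-- The Sobolev space `W^{2,∞}(Ω)`: functions in `L^∞(Ω)` which have a weak derivative, itself
in `W^{1,∞}(Ω)`. -/
structure MemW2Inf (Ω : Set G) (f : G → F) : Prop where
  memLp : MemLp f ⊤ (volume.restrict Ω)
  exists_weakFDeriv : ∃ g, HasWeakFDerivOn Ω f g
  memW1Inf_weakFDeriv : MemW1Inf Ω (weakFDeriv Ω f)

end Sobolev

namespace Particle

/-- The Euclidean plane. -/
abbrev Plane : Type := EuclideanSpace ℝ (Fin 2)

/-- Rotation by a quarter turn, `v^⊥ = (-v₂, v₁)`. -/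
def perp (v : Plane) : Plane := !₂[-(v 1), v 0]

/-- The space-time domain `(0,∞) × ℝ²`. -/
def spaceTime : Set (ℝ × Plane) := Ioi 0 ×ˢ univ

/-- `K_x = ‖D_x E‖_{L^∞((0,∞) × ℝ²)}`: the essential supremum of the Euclidean operator norm of
the spatial part of the weak derivative of `E`. -/
def Kx (E : ℝ × Plane → Plane) : ℝ :=
  (eLpNorm (fun p => (Sobolev.weakFDeriv spaceTime E p).comp (ContinuousLinearMap.inr ℝ ℝ Plane))
    ⊤ (volume.restrict spaceTime)).toReal

/-- `(x, v)` solves, on `[0,∞)`, the characteristic system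
`ε x' = v`, `ε v' = E(t, x) - v^⊥ / ε`, with `x(0) = x₀`, `v(0) = v₀`. -/
structure IsTrajectory (E : ℝ × Plane → Plane) (ε : ℝ) (x₀ v₀ : Plane) (x v : ℝ → Plane) :
    Prop where
  init_x : x 0 = x₀
  init_v : v 0 = v₀
  deriv_x : ∀ t : ℝ, 0 ≤ t → HasDerivWithinAt x (ε⁻¹ • v t) (Ici 0) t
  deriv_v : ∀ t : ℝ, 0 ≤ t →
    HasDerivWithinAt v (ε⁻¹ • (E (t, x t) - ε⁻¹ • perp (v t))) (Ici 0) t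

/-- `(xn, vn)` solves the first-order scheme with time step `Δt`, implicit in the velocity and
explicit in the field `E`, started at `(x₀, v₀)`. -/
structure IsScheme (E : ℝ × Plane → Plane) (ε Δt : ℝ) (x₀ v₀ : Plane) (xn vn : ℕ → Plane) :
    Prop where
  init_x : xn 0 = x₀
  init_v : vn 0 = v₀
  step_x : ∀ n : ℕ, Δt⁻¹ • (xn (n + 1) - xn n) = ε⁻¹ • vn (n + 1)
  step_v : ∀ n : ℕ,
    ε • (Δt⁻¹ • (vn (n + 1) - vn n)) = E (n * Δt, xn n) - ε⁻¹ • perp (vn (n + 1))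

/-- The guiding-center variable `y = x - ε v^⊥`. -/
def guidingCenter (ε : ℝ) (x v : Plane) : Plane := x - ε • perp v

end Particle

end

/-! Everything rests on the guiding center `y = x - ε v^⊥`. Applying the quarter turn to the
velocity equation cancels the stiff terms and leaves `y' = -E(t, x)^⊥`. The scheme inherits this
exactly (`IsScheme.guidingCenter_succ`): `y` advances by an explicit Euler step with no power of
`1/ε`.

Velocities are bounded uniformly in `ε`, with growth `e^{K t}`, by following `v + ε E^⊥`. For frozen
`E` this quantity rotates under the flow and contracts under the implicit step. The field varies at
rate `L + K ‖v‖ / ε`, and the factor `ε` in front absorbs the singular denominator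
(`IsTrajectory.norm_le`, `IsScheme.norm_le`).

Each minimum combines two independent estimates. The branch singular in `ε` is a consistency and
stability argument for `‖y error‖ + ε ‖v error‖`, which dominates the error in `x`
(`classical_error`). For the uniform branch of (i), `drift_error` compares the two guiding centers
and merely bounds the term `ε v^⊥`, at a cost `O(ε)`.

The uniform branch of (ii) gains an order by averaging (`averaged_error`). Expanding `E` at `y`, the
linear term is `D (ε v^⊥)`, and the velocity equation gives `ε v^⊥ = ε² E - ε³ v'`. The derivative
is removed by summation by parts, because `D` varies slowly along `y`; the scheme has a discrete
analogue. What remains is `O(Δt + ε²)`.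

Sobolev regularity enters only through pointwise Lipschitz and Taylor bounds on the closed half
space. They hold for mollifications centred slightly inside the domain, with the sharp constant `Kx
E`, and pass to the limit (`isLipschitzField_of_weakFDeriv`, `exists_isLipschitzDeriv_of_memW2Inf`).
-/

noncomputable section

namespace Particle

open Filter Topology Sobolev

/-! ### Mollification up to the boundary of the half space. -/

section

variable {F : Type*} [NormedAddCommGroup F] [NormedSpace ℝ F]

instance : (volume : Measure (ℝ × Plane)).IsAddHaarMeasure :=
  inferInstanceAs ((volume : Measure ℝ).prod (volume : Measure Plane)).IsAddHaarMeasure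

/-- Regularization parameter of the `n`-th mollification. -/
def mollStep (n : ℕ) : ℝ := 1 / ((n : ℝ) + 1)

lemma mollStep_pos (n : ℕ) : 0 < mollStep n := by unfold mollStep; positivity

lemma tendsto_mollStep : Tendsto mollStep atTop (𝓝 0) := tendsto_one_div_add_atTop_nhds_zero_nat

/-- A smooth bump function at the origin of space-time with radius half the mollification step. -/
def mollBump (n : ℕ) : ContDiffBump (0 : ℝ × Plane) where
  rIn := mollStep n / 4
  rOut := mollStep n / 2
  rIn_pos := by have := mollStep_pos n; linarith
  rIn_lt_rOut := by have := mollStep_pos n; linarith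

/-- The point `p` moved inside the half space by one mollification step. -/
def mollShift (n : ℕ) (p : ℝ × Plane) : ℝ × Plane := p + (mollStep n, 0)

/-- Mollification of a function on the half space `spaceTime`, with the centre of averaging moved
inwards, so that only values in `spaceTime` matter at points of the closed half space. -/
def moll (n : ℕ) (f : ℝ × Plane → F) (p : ℝ × Plane) : F :=
  convolution ((mollBump n).normed volume) (spaceTime.indicator f)
    (ContinuousLinearMap.lsmul ℝ ℝ) volume (mollShift n p)

lemma isOpen_spaceTime : IsOpen spaceTime := isOpen_Ioi.prod isOpen_univ

lemma measurableSet_spaceTime : MeasurableSet spaceTime := isOpen_spaceTime.measurableSet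

lemma mem_spaceTime {p : ℝ × Plane} : p ∈ spaceTime ↔ 0 < p.1 := by
  simp [spaceTime]

/-- The shift in time is twice the radius of the bump, so the averaging ball stays in the open half
space even when its base point has time zero. -/
lemma closedBall_mollShift_subset (n : ℕ) {p : ℝ × Plane} (hp : 0 ≤ p.1) :
    Metric.closedBall (mollShift n p) (mollStep n / 2) ⊆ spaceTime := by
  intro q hq
  have hs := mollStep_pos n
  rw [Metric.mem_closedBall, Prod.dist_eq] at hq
  have h1 := (le_max_left _ _).trans hq
  rw [Real.dist_eq] at h1
  have h2 := (abs_le.1 h1).1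
  simp only [mollShift, Prod.fst_add] at h2
  rw [mem_spaceTime]
  linarith

lemma locallyIntegrable_indicator {F : Type*} [NormedAddCommGroup F] {f : ℝ × Plane → F}
    (hf : MemLp f ⊤ (volume.restrict spaceTime)) :
    LocallyIntegrable (spaceTime.indicator f) volume :=
  ((memLp_indicator_iff_restrict measurableSet_spaceTime).2 hf).locallyIntegrable le_top

lemma moll_eq_integral (n : ℕ) (f : ℝ × Plane → F) (p : ℝ × Plane) :
    moll n f p = ∫ q, (mollBump n).normed volume (mollShift n p - q) • spaceTime.indicator f q := by
  unfold moll convolution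
  rw [← integral_sub_left_eq_self _ volume (mollShift n p)]
  simp

lemma integrable_moll (n : ℕ) {f : ℝ × Plane → F}
    (hf : MemLp f ⊤ (volume.restrict spaceTime)) (p : ℝ × Plane) :
    Integrable fun q => (mollBump n).normed volume (mollShift n p - q) •
      spaceTime.indicator f q := by
  have h := (HasCompactSupport.convolutionExists_left (ContinuousLinearMap.lsmul ℝ ℝ)
    ((mollBump n).hasCompactSupport_normed (μ := volume)) (mollBump n).continuous_normed
    (locallyIntegrable_indicator hf) (mollShift n p)).integrable
  have := h.comp_sub_left (mollShift n p)
  simpa using this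

/-- Almost everywhere bounds pass to mollifications. -/
lemma norm_map_moll_le [CompleteSpace F] {F' : Type*} [NormedAddCommGroup F'] [NormedSpace ℝ F']
    [CompleteSpace F']
    (n : ℕ) {f : ℝ × Plane → F} (hf : MemLp f ⊤ (volume.restrict spaceTime)) (A : F →L[ℝ] F')
    {C : ℝ} (hC0 : 0 ≤ C) (hC : ∀ᵐ q ∂(volume.restrict spaceTime), ‖A (f q)‖ ≤ C)
    (p : ℝ × Plane) : ‖A (moll n f p)‖ ≤ C := by
  -- The mollification is an average with a probability density. Carrying a linear map `A` through
  -- it allows the spatial part of the derivative to be bounded by `Kx E` rather than by the full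
  -- derivative norm.
  rw [moll_eq_integral, ← A.integral_comp_comm (integrable_moll n hf p)]
  have hb : Integrable fun q => (mollBump n).normed volume (mollShift n p - q) * C :=
    (((mollBump n).integrable_normed).comp_sub_left (mollShift n p)).mul_const C
  have hI : ∫ q, (mollBump n).normed volume (mollShift n p - q) * C = C := by
    rw [integral_mul_const, integral_sub_left_eq_self ((mollBump n).normed volume) volume,
      (mollBump n).integral_normed, one_mul]
  rw [← hI]
  refine norm_integral_le_of_norm_le hb ?_
  rw [ae_restrict_iff' measurableSet_spaceTime] at hC
  filter_upwards [hC] with q hq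
  rw [map_smul, norm_smul, Real.norm_of_nonneg ((mollBump n).nonneg_normed _)]
  refine mul_le_mul_of_nonneg_left ?_ ((mollBump n).nonneg_normed _)
  by_cases h : q ∈ spaceTime
  · rw [indicator_of_mem h]; exact hq h
  · rw [indicator_of_notMem h]; simpa using hC0

/-- On the closed half space, mollification commutes with weak differentiation. -/
lemma hasFDerivAt_moll [CompleteSpace F] (n : ℕ) {f : ℝ × Plane → F}
    {g : ℝ × Plane → (ℝ × Plane →L[ℝ] F)} (hf : MemLp f ⊤ (volume.restrict spaceTime))
    (hg : MemLp g ⊤ (volume.restrict spaceTime)) (h : HasWeakFDerivOn spaceTime f g)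
    {p : ℝ × Plane} (hp : 0 ≤ p.1) : HasFDerivAt (moll n f) (moll n g p) p := by
  set φ := (mollBump n).normed volume with hφ
  have hφc : HasCompactSupport φ := (mollBump n).hasCompactSupport_normed
  have hφs : ContDiff ℝ 1 φ := (mollBump n).contDiff_normed (n := 1)
  have hφi : ContDiff ℝ (⊤ : ℕ∞) φ := (mollBump n).contDiff_normed
  have hφd : ∀ x, DifferentiableAt ℝ φ x := fun x => (hφs.differentiable one_ne_zero) x
  have h1 := hφc.hasFDerivAt_convolution_left (ContinuousLinearMap.lsmul ℝ ℝ) hφs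
    (locallyIntegrable_indicator hf) (mollShift n p)
  have hshift : HasFDerivAt (mollShift n) (ContinuousLinearMap.id ℝ (ℝ × Plane)) p :=
    (hasFDerivAt_id p).add_const _
  have h2 := h1.comp p hshift
  rw [ContinuousLinearMap.comp_id] at h2
  have key : convolution (fderiv ℝ φ) (spaceTime.indicator f)
      (ContinuousLinearMap.precompL (ℝ × Plane) (ContinuousLinearMap.lsmul ℝ ℝ)) volume
      (mollShift n p) = moll n g p := by
    set c := mollShift n p with hc
    -- The reflected kernel is an admissible test function, since the shift keeps its support inside
    -- the open half space. The sign from reflection cancels the sign in the weak derivative.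
    set ψ : ℝ × Plane → ℝ := fun q => φ (c - q) with hψ
    have hψd : ∀ q, fderiv ℝ ψ q = -fderiv ℝ φ (c - q) := by
      intro q
      have hs : HasFDerivAt (fun q : ℝ × Plane => c - q)
          (-ContinuousLinearMap.id ℝ (ℝ × Plane)) q := (hasFDerivAt_id q).const_sub c
      have := ((hφd (c - q)).hasFDerivAt.comp q hs).fderiv
      rw [hψ]
      change fderiv ℝ (φ ∘ fun q => c - q) q = _
      rw [this]
      ext <;> simp
    have hsup : tsupport ψ ⊆ Metric.closedBall c (mollStep n / 2) := by
      refine closure_minimal ?_ Metric.isClosed_closedBall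
      intro q hq
      have : c - q ∈ tsupport φ := subset_tsupport _ hq
      rw [(mollBump n).tsupport_normed_eq, mem_closedBall_zero_iff] at this
      rw [Metric.mem_closedBall, dist_eq_norm, ← norm_neg, neg_sub]
      exact this
    have hψc : HasCompactSupport ψ :=
      (isCompact_closedBall c (mollStep n / 2)).of_isClosed_subset (isClosed_tsupport _) hsup
    have hsub : tsupport ψ ⊆ spaceTime := hsup.trans (closedBall_mollShift_subset n hp)
    have hψi : ContDiff ℝ (⊤ : ℕ∞) ψ := hφi.comp (contDiff_const.sub contDiff_id)
    have hwk := h.integral_eq ψ hψi hψc hsub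
    refine ContinuousLinearMap.ext fun w => ?_
    have hL := (hφc.fderiv (𝕜 := ℝ)).convolutionExists_left
      (ContinuousLinearMap.precompL (ℝ × Plane) (ContinuousLinearMap.lsmul ℝ ℝ))
      (hφs.continuous_fderiv one_ne_zero) (locallyIntegrable_indicator hf) c
    unfold convolution
    rw [ContinuousLinearMap.integral_apply hL.integrable, moll_eq_integral,
      ContinuousLinearMap.integral_apply (integrable_moll n hg p),
      ← integral_sub_left_eq_self _ volume c]
    have e1 : ∀ q, (((ContinuousLinearMap.precompL (ℝ × Plane)
        (ContinuousLinearMap.lsmul ℝ ℝ)) (fderiv ℝ φ (c - q)))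
        (spaceTime.indicator f (c - (c - q)))) w = -((fderiv ℝ ψ q w) • f q) := by
      intro q
      rw [hψd]
      by_cases hq : q ∈ spaceTime
      · simp [ContinuousLinearMap.precompL_apply, indicator_of_mem hq]
      · have : fderiv ℝ ψ q = 0 := by
          by_contra hne
          exact hq (hsub (support_fderiv_subset ℝ hne))
        rw [hψd, neg_eq_zero] at this
        simp [this]
    have e2 : ∀ q, (φ (c - q) • spaceTime.indicator g q) w = ψ q • g q w := by
      intro q
      by_cases hq : q ∈ spaceTime
      · simp [indicator_of_mem hq, hψ]
      · have : ψ q = 0 := by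
          by_contra hne
          exact hq (hsub (subset_tsupport _ hne))
        have h' : φ (c - q) = 0 := this
        simp [this, h']
    simp_rw [e1]
    rw [integral_neg, hwk w, neg_neg]
    exact integral_congr_ae (Eventually.of_forall fun q => (e2 q).symm)
  rw [key] at h2
  exact h2

/-- Mollifications converge at all points of the closed half space. -/
lemma tendsto_moll [CompleteSpace F] {f : ℝ × Plane → F}
    (hc : ContinuousOn f (Ici 0 ×ˢ univ)) (hf : MemLp f ⊤ (volume.restrict spaceTime))
    {p : ℝ × Plane} (hp : 0 ≤ p.1) : Tendsto (fun n => moll n f p) atTop (𝓝 (f p)) := by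
  rw [Metric.tendsto_atTop']
  intro ε hε
  have h1 := hc p ⟨hp, mem_univ _⟩
  rw [Metric.continuousWithinAt_iff] at h1
  obtain ⟨δ, hδ, h⟩ := h1 (ε / 2) (by linarith)
  obtain ⟨N, hN⟩ := (Metric.tendsto_atTop.1 tendsto_mollStep) (δ / 2) (by linarith)
  refine ⟨N, fun n hn => ?_⟩
  have hs := mollStep_pos n
  have hsδ : mollStep n < δ / 2 := by
    have := hN n hn.le
    rwa [Real.dist_eq, sub_zero, abs_of_pos hs] at this
  refine lt_of_le_of_lt ?_ (half_lt_self hε)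
  refine dist_convolution_le (R := mollStep n / 2) (by linarith) ?_
    (mollBump n).nonneg_normed (mollBump n).integral_normed
    ((memLp_indicator_iff_restrict measurableSet_spaceTime).2 hf).aestronglyMeasurable ?_
  · rw [(mollBump n).support_normed_eq, mollBump]
  · intro q hq
    have hq' := closedBall_mollShift_subset n hp (Metric.ball_subset_closedBall hq)
    rw [indicator_of_mem hq']
    refine (h ⟨(mem_spaceTime.1 hq').le, mem_univ _⟩ ?_).le
    have h2 : dist (mollShift n p) p ≤ mollStep n := by
      rw [mollShift, dist_eq_norm, add_sub_cancel_left, Prod.norm_def]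
      simp [abs_of_pos hs, hs.le]
    calc dist q p ≤ dist q (mollShift n p) + dist (mollShift n p) p := dist_triangle _ _ _
      _ < mollStep n / 2 + mollStep n := add_lt_add_of_lt_of_le hq h2
      _ < δ := by linarith

end

/-! ### From Sobolev regularity to pointwise bounds. -/

section

/-- `E` is bounded by `M` for nonnegative times, and there Lipschitz with constant `L` in time and
constant `K` in space. -/
structure IsLipschitzField (E : ℝ × Plane → Plane) (M L K : ℝ) : Prop where
  bound_nonneg : 0 ≤ M
  time_nonneg : 0 ≤ L
  space_nonneg : 0 ≤ K
  norm_le : ∀ {t : ℝ} (x : Plane), 0 ≤ t → ‖E (t, x)‖ ≤ M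
  norm_sub_le : ∀ {s t : ℝ} (x y : Plane), 0 ≤ s → 0 ≤ t →
    ‖E (t, x) - E (s, y)‖ ≤ L * |t - s| + K * ‖x - y‖

/-- `D` is a spatial derivative of `E` for nonnegative times, bounded by `K`, Lipschitz with
constant `Q`, and with a quadratic Taylor remainder. -/
structure IsLipschitzDeriv (E : ℝ × Plane → Plane) (D : ℝ × Plane → Plane →L[ℝ] Plane)
    (K Q : ℝ) : Prop where
  nonneg : 0 ≤ Q
  norm_le : ∀ {t : ℝ} (x : Plane), 0 ≤ t → ‖D (t, x)‖ ≤ K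
  norm_sub_le : ∀ {s t : ℝ} (x y : Plane), 0 ≤ s → 0 ≤ t →
    ‖D (t, x) - D (s, y)‖ ≤ Q * (|t - s| + ‖x - y‖)
  taylor : ∀ {t : ℝ} (x h : Plane), 0 ≤ t →
    ‖E (t, x + h) - E (t, x) - D (t, x) h‖ ≤ Q * ‖h‖ ^ 2

lemma ae_norm_le_toReal {α F : Type*} [MeasurableSpace α] [NormedAddCommGroup F] {μ : Measure α}
    {f : α → F} (hf : eLpNorm f ⊤ μ ≠ ⊤) : ∀ᵐ q ∂μ, ‖f q‖ ≤ (eLpNorm f ⊤ μ).toReal := by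
  filter_upwards [ae_le_eLpNormEssSup (f := f) (μ := μ)] with q hq
  rw [← toReal_enorm]
  exact ENNReal.toReal_mono hf (by rwa [eLpNorm_exponent_top])

lemma hasWeakFDerivOn_weakFDeriv {F : Type*} [NormedAddCommGroup F] [NormedSpace ℝ F]
    {f : ℝ × Plane → F} {Ω : Set (ℝ × Plane)} (h : ∃ g, HasWeakFDerivOn Ω f g) :
    HasWeakFDerivOn Ω f (weakFDeriv Ω f) := by
  unfold weakFDeriv
  rw [dif_pos h]
  exact h.choose_spec

/-- The restriction of linear maps on space-time to space, as a continuous linear map. -/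
def spacePart : (ℝ × Plane →L[ℝ] Plane) →L[ℝ] (Plane →L[ℝ] Plane) :=
  (ContinuousLinearMap.compL ℝ Plane (ℝ × Plane) Plane).flip (ContinuousLinearMap.inr ℝ ℝ Plane)

lemma spacePart_apply (A : ℝ × Plane →L[ℝ] Plane) :
    spacePart A = A.comp (ContinuousLinearMap.inr ℝ ℝ Plane) := rfl

lemma norm_spacePart_le (A : ℝ × Plane →L[ℝ] Plane) : ‖spacePart A‖ ≤ ‖A‖ := by
  rw [spacePart_apply]
  refine ContinuousLinearMap.opNorm_le_bound _ (norm_nonneg _) fun h => ?_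
  refine (A.le_opNorm _).trans (mul_le_mul_of_nonneg_left ?_ (norm_nonneg _))
  simp [Prod.norm_def]

variable {E : ℝ × Plane → Plane}

lemma Kx_nonneg : 0 ≤ Kx E := ENNReal.toReal_nonneg

lemma ae_norm_spacePart_weakFDeriv_le
    (h : MemLp (weakFDeriv spaceTime E) ⊤ (volume.restrict spaceTime)) :
    ∀ᵐ q ∂(volume.restrict spaceTime), ‖spacePart (weakFDeriv spaceTime E q)‖ ≤ Kx E := by
  refine ae_norm_le_toReal (f := fun q => spacePart (weakFDeriv spaceTime E q)) ?_
  refine ne_top_of_le_ne_top h.2.ne ?_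
  exact eLpNorm_mono fun q => norm_spacePart_le _

lemma norm_spacePart_moll_le
    (h : MemLp (weakFDeriv spaceTime E) ⊤ (volume.restrict spaceTime)) (n : ℕ) (p : ℝ × Plane) :
    ‖spacePart (moll n (weakFDeriv spaceTime E) p)‖ ≤ Kx E :=
  norm_map_moll_le n h spacePart Kx_nonneg (ae_norm_spacePart_weakFDeriv_le h) p

/-- A continuous representative of a function with bounded weak derivative is Lipschitz, in space
with constant `Kx E`. -/
lemma isLipschitzField_of_weakFDeriv (hc : ContinuousOn E (Ici 0 ×ˢ univ))
    (hE : MemLp E ⊤ (volume.restrict spaceTime)) (hex : ∃ g, HasWeakFDerivOn spaceTime E g)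
    (hg : MemLp (weakFDeriv spaceTime E) ⊤ (volume.restrict spaceTime)) :
    ∃ M L, IsLipschitzField E M L (Kx E) := by
  set g := weakFDeriv spaceTime E with hgdef
  have hw : HasWeakFDerivOn spaceTime E g := hasWeakFDerivOn_weakFDeriv hex
  set M := (eLpNorm E ⊤ (volume.restrict spaceTime)).toReal
  set L := (eLpNorm g ⊤ (volume.restrict spaceTime)).toReal
  have hM : ∀ᵐ q ∂(volume.restrict spaceTime), ‖E q‖ ≤ M := ae_norm_le_toReal hE.2.ne
  have hL : ∀ᵐ q ∂(volume.restrict spaceTime), ‖g q‖ ≤ L := ae_norm_le_toReal hg.2.ne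
  have hM0 : 0 ≤ M := ENNReal.toReal_nonneg
  have hL0 : 0 ≤ L := ENNReal.toReal_nonneg
  refine ⟨M, L, hM0, hL0, Kx_nonneg, fun {t} x ht => ?_, fun {s t} x y hs ht => ?_⟩
  · exact le_of_tendsto (tendsto_moll hc hE (p := (t, x)) ht).norm (Eventually.of_forall fun n =>
      norm_map_moll_le n hE (ContinuousLinearMap.id ℝ Plane) hM0 hM _)
  -- Space and time increments are treated separately, so that the spatial constant is exactly `Kx
  -- E`, the rate appearing in the final exponential.
  · have h1 : ‖E (t, x) - E (t, y)‖ ≤ Kx E * ‖x - y‖ := by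
      refine le_of_tendsto ((tendsto_moll hc hE (p := (t, x)) ht).sub
        (tendsto_moll hc hE (p := (t, y)) ht)).norm (Eventually.of_forall fun n => ?_)
      refine Convex.norm_image_sub_le_of_norm_hasFDerivWithin_le (𝕜 := ℝ)
        (f := fun z => moll n E (t, z)) (f' := fun z => spacePart (moll n g (t, z)))
        (s := univ) (fun z _ => ?_) (fun z _ => norm_spacePart_moll_le hg n _) convex_univ
        (mem_univ _) (mem_univ _)
      exact ((hasFDerivAt_moll n hE hg hw (p := (t, z)) ht).comp z
        (hasFDerivAt_prodMk_right t z)).hasFDerivWithinAt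
    have h2 : ‖E (t, y) - E (s, y)‖ ≤ L * |t - s| := by
      refine le_of_tendsto ((tendsto_moll hc hE (p := (t, y)) ht).sub
        (tendsto_moll hc hE (p := (s, y)) hs)).norm (Eventually.of_forall fun n => ?_)
      refine Convex.norm_image_sub_le_of_norm_hasFDerivWithin_le (𝕜 := ℝ)
        (f := fun r => moll n E (r, y))
        (f' := fun r => (moll n g (r, y)).comp (ContinuousLinearMap.inl ℝ ℝ Plane))
        (s := Ici 0) (fun r hr => ?_) (fun r _ => ?_) (convex_Ici 0) hs ht
      · have hm : HasFDerivAt (moll n E) (moll n g (r, y)) (r, y) :=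
          hasFDerivAt_moll n hE hg hw hr
        exact (HasFDerivAt.comp (f := fun r : ℝ => (r, y)) r hm
          (hasFDerivAt_prodMk_left r y)).hasFDerivWithinAt
      · refine (ContinuousLinearMap.opNorm_le_bound _ (norm_nonneg (moll n g (r, y)))
          fun h => ?_).trans
          (norm_map_moll_le n hg (ContinuousLinearMap.id ℝ _) hL0 hL (r, y))
        refine ((moll n g (r, y)).le_opNorm _).trans (mul_le_mul_of_nonneg_left ?_ (norm_nonneg _))
        simp [Prod.norm_def]
    calc ‖E (t, x) - E (s, y)‖ = ‖(E (t, y) - E (s, y)) + (E (t, x) - E (t, y))‖ := by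
          congr 1; abel
      _ ≤ _ := (norm_add_le _ _).trans (add_le_add h2 h1)

lemma isLipschitzField_of_memW1Inf (hc : ContinuousOn E (Ici 0 ×ˢ univ))
    (h : MemW1Inf spaceTime E) : ∃ M L, IsLipschitzField E M L (Kx E) :=
  isLipschitzField_of_weakFDeriv hc h.memLp h.exists_weakFDeriv h.memLp_weakFDeriv

lemma isLipschitzField_of_memW2Inf (hc : ContinuousOn E (Ici 0 ×ˢ univ))
    (h : MemW2Inf spaceTime E) : ∃ M L, IsLipschitzField E M L (Kx E) :=
  isLipschitzField_of_weakFDeriv hc h.memLp h.exists_weakFDeriv h.memW1Inf_weakFDeriv.memLp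

/-- Functions in `W^{2,∞}` have a Lipschitz spatial derivative up to the initial time. -/
lemma exists_isLipschitzDeriv_of_memW2Inf (hc : ContinuousOn E (Ici 0 ×ˢ univ))
    (h : MemW2Inf spaceTime E) : ∃ D Q, IsLipschitzDeriv E D (Kx E) Q := by
  have hE := h.memLp
  have hw := hasWeakFDerivOn_weakFDeriv h.exists_weakFDeriv
  have hg := h.memW1Inf_weakFDeriv.memLp
  have hw2 := hasWeakFDerivOn_weakFDeriv h.memW1Inf_weakFDeriv.exists_weakFDeriv
  have hH := h.memW1Inf_weakFDeriv.memLp_weakFDeriv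
  set g := weakFDeriv spaceTime E with hgdef
  set H := weakFDeriv spaceTime g with hHdef
  set Q := (eLpNorm H ⊤ (volume.restrict spaceTime)).toReal
  have hQ : ∀ᵐ q ∂(volume.restrict spaceTime), ‖H q‖ ≤ Q := ae_norm_le_toReal hH.2.ne
  have hQ0 : 0 ≤ Q := ENNReal.toReal_nonneg
  have hlip : ∀ n (s t : ℝ) (x y : Plane), 0 ≤ s → 0 ≤ t →
      ‖spacePart (moll n g (t, x)) - spacePart (moll n g (s, y))‖ ≤ Q * (|t - s| + ‖x - y‖) := by
    intro n s t x y hs ht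
    rw [← map_sub]
    refine (norm_spacePart_le _).trans ?_
    have h1 := Convex.norm_image_sub_le_of_norm_hasFDerivWithin_le (𝕜 := ℝ)
      (f := moll n g) (f' := moll n H) (C := Q) (s := Ici (0 : ℝ) ×ˢ (univ : Set Plane))
      (fun p hp => (hasFDerivAt_moll n hg hH hw2 hp.1).hasFDerivWithinAt)
      (fun p _ => norm_map_moll_le n hH (ContinuousLinearMap.id ℝ _) hQ0 hQ p)
      ((convex_Ici 0).prod convex_univ) (x := (s, y)) (y := (t, x)) ⟨hs, mem_univ _⟩
      ⟨ht, mem_univ _⟩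
    refine h1.trans (mul_le_mul_of_nonneg_left ?_ hQ0)
    rw [Prod.norm_def]
    exact max_le_add_of_nonneg (norm_nonneg _) (norm_nonneg _)
  have htaylor : ∀ n (t : ℝ) (x z : Plane), 0 ≤ t →
      ‖moll n E (t, x + z) - moll n E (t, x) - spacePart (moll n g (t, x)) z‖ ≤ Q * ‖z‖ ^ 2 := by
    intro n t x z ht
    have h1 := Convex.norm_image_sub_le_of_norm_hasFDerivWithin_le' (𝕜 := ℝ)
      (f := fun y => moll n E (t, y)) (f' := fun y => spacePart (moll n g (t, y)))
      (φ := spacePart (moll n g (t, x))) (C := Q * ‖z‖)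
      -- On this ball the derivative differs from its value at `x` by at most `Q * ‖z‖`; the mean
      -- value inequality supplies the second factor `‖z‖`.
      (s := Metric.closedBall x ‖z‖) (x := x) (y := x + z)
      (fun y _ => ((hasFDerivAt_moll n hE hg hw (p := (t, y)) ht).comp y
        (hasFDerivAt_prodMk_right t y)).hasFDerivWithinAt)
      (fun y hy => by
        have := hlip n t t y x ht ht
        rw [sub_self, abs_zero, zero_add] at this
        rw [Metric.mem_closedBall, dist_eq_norm] at hy
        exact this.trans (mul_le_mul_of_nonneg_left hy hQ0))
      (convex_closedBall x ‖z‖) (Metric.mem_closedBall_self (norm_nonneg _))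
      (by simp)
    rw [add_sub_cancel_left] at h1
    calc _ ≤ _ := h1
      _ = _ := by ring
  -- The weak derivative has no chosen continuous representative, so pointwise convergence of its
  -- mollifications is not at hand. Compactness of balls of linear maps gives a limit along one
  -- ultrafilter at every point at once, and all the inequalities are closed conditions.
  let U : Ultrafilter ℕ := hyperfilter ℕ
  have hU : (U : Filter ℕ) ≤ atTop := by
    rw [← Nat.cofinite_eq_atTop]; exact hyperfilter_le_cofinite
  have hlim : ∀ p : ℝ × Plane, ∃ A : Plane →L[ℝ] Plane,
      Tendsto (fun n => spacePart (moll n g p)) U (𝓝 A) := by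
    intro p
    obtain ⟨A, -, hA⟩ := (isCompact_closedBall (0 : Plane →L[ℝ] Plane)
      (Kx E)).ultrafilter_le_nhds (U.map fun n => spacePart (moll n g p)) (by
        rw [le_principal_iff]
        exact Eventually.of_forall (f := (U : Filter ℕ)) fun n =>
          mem_closedBall_zero_iff.2 (norm_spacePart_moll_le hg n p))
    exact ⟨A, hA⟩
  choose D hD using hlim
  refine ⟨D, Q, hQ0, fun {t} x _ => ?_, fun {s t} x y hs ht => ?_, fun {t} x z ht => ?_⟩
  · exact le_of_tendsto (hD (t, x)).norm
      (Eventually.of_forall fun n => norm_spacePart_moll_le hg n _)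
  · exact le_of_tendsto ((hD (t, x)).sub (hD (s, y))).norm
      (Eventually.of_forall fun n => hlip n s t x y hs ht)
  · have e1 := (tendsto_moll hc hE (p := (t, x + z)) ht).mono_left hU
    have e2 := (tendsto_moll hc hE (p := (t, x)) ht).mono_left hU
    have e3 := ((ContinuousLinearMap.apply ℝ Plane z).continuous.tendsto _).comp (hD (t, x))
    exact le_of_tendsto ((e1.sub e2).sub e3).norm
      (Eventually.of_forall fun n => htaylor n t x z ht)

end

/-! ### Planar algebra, solvability of the scheme, Gronwall lemmas. -/

section

/-! ### The quarter turn -/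

lemma perp_add (v w : Plane) : perp (v + w) = perp v + perp w := by
  ext i; fin_cases i <;> simp [perp]; ring

lemma perp_smul (c : ℝ) (v : Plane) : perp (c • v) = c • perp v := by
  ext i; fin_cases i <;> simp [perp]

lemma perp_perp (v : Plane) : perp (perp v) = -v := by
  ext i; fin_cases i <;> simp [perp]

/-- The quarter turn as a continuous linear map. -/
def perpCLM : Plane →L[ℝ] Plane :=
  LinearMap.toContinuousLinearMap
    { toFun := perp
      map_add' := perp_add
      map_smul' := perp_smul }

lemma perp_sub (v w : Plane) : perp (v - w) = perp v - perp w := perpCLM.map_sub v w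

lemma perp_sum {ι : Type*} (s : Finset ι) (f : ι → Plane) :
    perp (∑ i ∈ s, f i) = ∑ i ∈ s, perp (f i) := map_sum perpCLM f s

lemma norm_perp (v : Plane) : ‖perp v‖ = ‖v‖ := by
  simp only [EuclideanSpace.norm_eq, Fin.sum_univ_two, perp]
  simp [add_comm]

lemma norm_add_smul_perp_sq (c : ℝ) (v : Plane) :
    ‖v + c • perp v‖ ^ 2 = (1 + c ^ 2) * ‖v‖ ^ 2 := by
  simp only [EuclideanSpace.norm_sq_eq, Fin.sum_univ_two, perp]
  simp
  ring

/-- A vector and its quarter turn are orthogonal. This is the unconditional stability of the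
implicit step, whatever the size of `Δt / ε ^ 2`. -/
lemma norm_le_norm_add_smul_perp (c : ℝ) (v : Plane) : ‖v‖ ≤ ‖v + c • perp v‖ := by
  refine (sq_le_sq₀ (norm_nonneg _) (norm_nonneg _)).1 ?_
  rw [norm_add_smul_perp_sq]
  nlinarith [sq_nonneg (c * ‖v‖)]

/-- The excess is quadratic in `c`, not linear: an infinitesimal rotation does not change the norm
to first order. -/
lemma norm_add_smul_perp_le (c : ℝ) (v : Plane) : ‖v + c • perp v‖ ≤ (1 + c ^ 2) * ‖v‖ := by
  refine (sq_le_sq₀ (norm_nonneg _) (by positivity)).1 ?_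
  rw [norm_add_smul_perp_sq, mul_pow]
  refine mul_le_mul_of_nonneg_right ?_ (sq_nonneg _)
  nlinarith [sq_nonneg c, sq_nonneg (c ^ 2)]

lemma hasDerivWithinAt_perp {f : ℝ → Plane} {f' : Plane} {s : Set ℝ} {t : ℝ}
    (h : HasDerivWithinAt f f' s t) :
    HasDerivWithinAt (fun r => perp (f r)) (perp f') s t :=
  perpCLM.hasFDerivAt.comp_hasDerivWithinAt t h

/-! ### The scheme -/

lemma scheme_step_iff {ε Δt : ℝ} (hε : 0 < ε) (hΔ : 0 < Δt) (v w e : Plane) :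
    ε • (Δt⁻¹ • (w - v)) = e - ε⁻¹ • perp w ↔
      w + (Δt / ε ^ 2) • perp w = v + (Δt / ε) • e := by
  have h : ε • (Δt⁻¹ • (w - v)) - (e - ε⁻¹ • perp w) =
      (ε / Δt) • (w + (Δt / ε ^ 2) • perp w - (v + (Δt / ε) • e)) := by
    match_scalars <;> field_simp
  rw [← sub_eq_zero, h, smul_eq_zero, sub_eq_zero]
  have : ε / Δt ≠ 0 := by positivity
  tauto

/-- The solution operator of `w + c • w^⊥ = b`. -/
def resolvent (c : ℝ) (b : Plane) : Plane := (1 + c ^ 2)⁻¹ • (b - c • perp b)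

lemma eq_resolvent_iff (c : ℝ) (b w : Plane) : w + c • perp w = b ↔ w = resolvent c b := by
  have hc : 1 + c ^ 2 ≠ 0 := by positivity
  unfold resolvent
  constructor
  · rintro rfl
    rw [perp_add, perp_smul, perp_perp]
    match_scalars
    · field_simp
      ring
    · field_simp
      ring
  · rintro rfl
    rw [perp_smul, perp_sub, perp_smul, perp_perp]
    match_scalars
    · field_simp
    · field_simp
      ring

/-- One step of the scheme. -/
def schemeNext (E : ℝ × Plane → Plane) (ε Δt t : ℝ) (p : Plane × Plane) : Plane × Plane :=
  (p.1 + (Δt / ε) • resolvent (Δt / ε ^ 2) (p.2 + (Δt / ε) • E (t, p.1)),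
    resolvent (Δt / ε ^ 2) (p.2 + (Δt / ε) • E (t, p.1)))

/-- The iterates of the scheme. -/
def schemeSeq (E : ℝ × Plane → Plane) (ε Δt : ℝ) (x₀ v₀ : Plane) : ℕ → Plane × Plane
  | 0 => (x₀, v₀)
  | n + 1 => schemeNext E ε Δt (n * Δt) (schemeSeq E ε Δt x₀ v₀ n)

lemma scheme_step_x_iff {ε Δt : ℝ} (hΔ : 0 < Δt) (x y w : Plane) :
    Δt⁻¹ • (y - x) = ε⁻¹ • w ↔ y = x + (Δt / ε) • w := by
  have h : Δt⁻¹ • (y - x) - ε⁻¹ • w = Δt⁻¹ • (y - (x + (Δt / ε) • w)) := by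
    match_scalars <;> field_simp
  rw [← sub_eq_zero, h, smul_eq_zero, sub_eq_zero]
  have : Δt⁻¹ ≠ 0 := by positivity
  tauto

theorem existsUnique_isScheme (E : ℝ × Plane → Plane) {ε Δt : ℝ} (hε : 0 < ε) (hΔ : 0 < Δt)
    (x₀ v₀ : Plane) :
    ∃! s : (ℕ → Plane) × (ℕ → Plane), IsScheme E ε Δt x₀ v₀ s.1 s.2 := by
  refine ⟨(fun n => (schemeSeq E ε Δt x₀ v₀ n).1, fun n => (schemeSeq E ε Δt x₀ v₀ n).2),
    ⟨rfl, rfl, fun n => (scheme_step_x_iff hΔ _ _ _).2 rfl,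
      fun n => (scheme_step_iff hε hΔ _ _ _).2 ((eq_resolvent_iff _ _ _).2 rfl)⟩, ?_⟩
  rintro ⟨xn, vn⟩ ⟨hx0, hv0, hx, hv⟩
  have key : ∀ n, (xn n, vn n) = schemeSeq E ε Δt x₀ v₀ n := by
    intro n
    induction n with
    | zero => exact Prod.ext hx0 hv0
    | succ n ih =>
      have hv' := (eq_resolvent_iff _ _ _).1 ((scheme_step_iff hε hΔ _ _ _).1 (hv n))
      have hx' := (scheme_step_x_iff hΔ _ _ _).1 (hx n)
      dsimp only at hv' hx'
      rw [schemeSeq, ← ih, schemeNext, hx', hv']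
  refine Prod.ext (funext fun n => ?_) (funext fun n => ?_)
  · exact congrArg Prod.fst (key n)
  · exact congrArg Prod.snd (key n)

section Scheme

variable {E : ℝ × Plane → Plane} {ε Δt : ℝ} {x₀ v₀ : Plane} {xn vn : ℕ → Plane}

lemma IsScheme.x_succ (h : IsScheme E ε Δt x₀ v₀ xn vn) (hΔ : 0 < Δt) (n : ℕ) :
    xn (n + 1) = xn n + (Δt / ε) • vn (n + 1) :=
  (scheme_step_x_iff hΔ _ _ _).1 (h.step_x n)

lemma IsScheme.v_succ (h : IsScheme E ε Δt x₀ v₀ xn vn) (hε : 0 < ε) (hΔ : 0 < Δt) (n : ℕ) :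
    vn (n + 1) + (Δt / ε ^ 2) • perp (vn (n + 1)) = vn n + (Δt / ε) • E (n * Δt, xn n) :=
  (scheme_step_iff hε hΔ _ _ _).1 (h.step_v n)

/-- The quarter turn of the velocity update contains `(Δt / ε ^ 2) • vn (n + 1)`; multiplied by `ε`,
it is exactly the increment of the position, and the two cancel. -/
lemma IsScheme.guidingCenter_succ (h : IsScheme E ε Δt x₀ v₀ xn vn) (hε : 0 < ε) (hΔ : 0 < Δt)
    (n : ℕ) : guidingCenter ε (xn (n + 1)) (vn (n + 1)) =
      guidingCenter ε (xn n) (vn n) - Δt • perp (E (n * Δt, xn n)) := by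
  have hv := congrArg perp (h.v_succ hε hΔ n)
  rw [perp_add, perp_add, perp_smul, perp_smul, perp_perp] at hv
  have hv' : perp (vn (n + 1)) = perp (vn n) + (Δt / ε) • perp (E (n * Δt, xn n)) +
      (Δt / ε ^ 2) • vn (n + 1) := by
    rw [← hv]; module
  unfold guidingCenter
  rw [h.x_succ hΔ n, hv']
  match_scalars <;> field_simp
  ring

end Scheme

/-! ### Gronwall inequalities -/

lemma one_add_mul_exp_le {K κ h : ℝ} (hK : K ≤ κ) (hh : 0 ≤ h) (n : ℕ) :
    (1 + K * h) * Real.exp (κ * (n * h)) ≤ Real.exp (κ * ((n + 1 : ℕ) * h)) := by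
  have h1 : 1 + K * h ≤ Real.exp (κ * h) := by
    have := Real.add_one_le_exp (κ * h)
    nlinarith [mul_le_mul_of_nonneg_right hK hh]
  calc _ ≤ Real.exp (κ * h) * Real.exp (κ * (n * h)) :=
        mul_le_mul_of_nonneg_right h1 (Real.exp_pos _).le
    _ = _ := by rw [← Real.exp_add]; congr 1; push_cast; ring

/-- Discrete Gronwall inequality with an exponentially growing source. -/
lemma discrete_gronwall {a : ℕ → ℝ} {K κ h b α : ℝ} {N : ℕ} (hK : 0 ≤ K) (hκ : K ≤ κ)
    (hh : 0 ≤ h) (hb : 0 ≤ b) (hα : 0 ≤ α) (h0 : a 0 ≤ α)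
    (hs : ∀ n < N, a (n + 1) ≤ (1 + K * h) * a n + h * (b * Real.exp (κ * ((n + 1 : ℕ) * h)))) :
    ∀ n ≤ N, a n ≤ (α + n * h * b) * Real.exp (κ * (n * h)) := by
  intro n
  induction n with
  | zero => intro _; simpa using h0
  | succ n ih =>
    intro hn
    have h1 := ih (by omega)
    have h2 := one_add_mul_exp_le hκ hh n
    have h3 : 0 ≤ α + n * h * b := by positivity
    calc a (n + 1) ≤ (1 + K * h) * a n + h * (b * Real.exp (κ * ((n + 1 : ℕ) * h))) :=
          hs n (by omega)
      _ ≤ (1 + K * h) * ((α + n * h * b) * Real.exp (κ * (n * h))) +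
          h * (b * Real.exp (κ * ((n + 1 : ℕ) * h))) := by gcongr
      _ = (α + n * h * b) * ((1 + K * h) * Real.exp (κ * (n * h))) +
          h * (b * Real.exp (κ * ((n + 1 : ℕ) * h))) := by ring
      _ ≤ (α + n * h * b) * Real.exp (κ * ((n + 1 : ℕ) * h)) +
          h * (b * Real.exp (κ * ((n + 1 : ℕ) * h))) := by gcongr
      _ = _ := by push_cast; ring

/-- Discrete Gronwall inequality in summed form, with an exponentially growing source of at least
twice the rate. -/
lemma discrete_gronwall_sum {a : ℕ → ℝ} {K h b : ℝ} {N : ℕ} (hK : 0 ≤ K) (hh : 0 ≤ h)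
    (hb : 0 ≤ b)
    (hs : ∀ n ≤ N, a n ≤ b * Real.exp (2 * K * (n * h)) + K * h * ∑ k ∈ Finset.range n, a k) :
    ∀ n ≤ N, a n ≤ 2 * b * Real.exp (2 * K * (n * h)) := by
  have hsum : ∀ n : ℕ, 2 * (K * h * ∑ k ∈ Finset.range n, Real.exp (2 * K * (k * h))) ≤
      Real.exp (2 * K * (n * h)) := by
    intro n
    induction n with
    | zero => simp
    | succ n ih =>
      have := one_add_mul_exp_le (le_refl (2 * K)) hh n
      rw [Finset.sum_range_succ]
      linarith
  intro n
  induction n using Nat.strong_induction_on with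
  | _ n ih =>
    intro hn
    have h1 : ∑ k ∈ Finset.range n, a k ≤
        ∑ k ∈ Finset.range n, 2 * b * Real.exp (2 * K * (k * h)) :=
      Finset.sum_le_sum fun k hk => by
        have := Finset.mem_range.1 hk
        exact ih k this (by omega)
    have h2 := mul_le_mul_of_nonneg_left h1 (by positivity : 0 ≤ K * h)
    rw [← Finset.mul_sum] at h2
    have h3 := mul_le_mul_of_nonneg_left (hsum n) hb
    have h4 := hs n hn
    linarith

lemma gronwallBound_le {δ K b x : ℝ} (hK : 0 ≤ K) (hb : 0 ≤ b) :
    gronwallBound δ K b x ≤ (δ + b * x) * Real.exp (K * x) := by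
  rcases hK.eq_or_lt with rfl | hK
  · simp [gronwallBound_K0]
  · rw [gronwallBound_of_K_ne_0 hK.ne']
    -- This absorbs the `1 / K` of the Gronwall bound, making it uniform as `K` tends to zero.
    have h1 : Real.exp (K * x) - 1 ≤ K * x * Real.exp (K * x) := by
      have h2 := Real.add_one_le_exp (-(K * x))
      have h3 := mul_le_mul_of_nonneg_right h2 (Real.exp_pos (K * x)).le
      rw [← Real.exp_add, neg_add_cancel, Real.exp_zero] at h3
      linarith
    have h2 : b / K * (Real.exp (K * x) - 1) ≤ b / K * (K * x * Real.exp (K * x)) := by gcongr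
    have h3 : b / K * (K * x * Real.exp (K * x)) = b * x * Real.exp (K * x) := by field_simp
    dsimp only
    linarith

end

/-! ### Velocity bounds uniform in `ε`. -/

section

variable {E : ℝ × Plane → Plane} {M L K ε Δt : ℝ} {x₀ v₀ : Plane}

/-- The prefactor of `e^{K t}` in the velocity bounds on `[0, T]`. -/
def velocityFactor (M L K ε : ℝ) (v₀ : Plane) (T : ℝ) : ℝ :=
  ‖v₀‖ + ε * (2 * M + (L + K * M) * T)

lemma IsLipschitzField.velocityFactor_nonneg (hE : IsLipschitzField E M L K) (hε : 0 < ε)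
    {T : ℝ} (hT : 0 ≤ T) : 0 ≤ velocityFactor M L K ε v₀ T := by
  have := hE.bound_nonneg
  have := hE.time_nonneg
  have := hE.space_nonneg
  unfold velocityFactor
  positivity

lemma IsLipschitzField.velocityFactor_mono (hE : IsLipschitzField E M L K) (hε : 0 < ε)
    {S T : ℝ} (hST : S ≤ T) : velocityFactor M L K ε v₀ S ≤ velocityFactor M L K ε v₀ T := by
  have := hE.bound_nonneg
  have := hE.time_nonneg
  have := hE.space_nonneg
  unfold velocityFactor
  gcongr

/-! ### Velocity bound for the scheme -/

/-- The drift velocity `-ε E^⊥` is the fixed point of the step with frozen field. Relative to it,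
the implicit step inverts `w ↦ w + c w^⊥`, which never shrinks norms. -/
lemma IsScheme.norm_add_perp_le {xn vn : ℕ → Plane} (h : IsScheme E ε Δt x₀ v₀ xn vn)
    (hε : 0 < ε) (hΔ : 0 < Δt) (n : ℕ) :
    ‖vn (n + 1) + ε • perp (E (n * Δt, xn n))‖ ≤ ‖vn n + ε • perp (E (n * Δt, xn n))‖ := by
  refine (norm_le_norm_add_smul_perp (Δt / ε ^ 2) _).trans_eq ?_
  congr 1
  have hv := h.v_succ hε hΔ n
  have hv' : vn n = vn (n + 1) + (Δt / ε ^ 2) • perp (vn (n + 1)) -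
      (Δt / ε) • E (n * Δt, xn n) := by rw [hv]; module
  rw [hv', perp_add, perp_smul, perp_perp]
  match_scalars <;> field_simp

lemma IsScheme.norm_le {xn vn : ℕ → Plane} (h : IsScheme E ε Δt x₀ v₀ xn vn)
    (hE : IsLipschitzField E M L K) (hε : 0 < ε) (hΔ : 0 < Δt) (n : ℕ) :
    ‖vn n‖ ≤ velocityFactor M L K ε v₀ (n * Δt) * Real.exp (K * (n * Δt)) := by
  have hM := hE.bound_nonneg
  have hL := hE.time_nonneg
  have hK := hE.space_nonneg
  have ht : ∀ n : ℕ, 0 ≤ (n : ℝ) * Δt := fun n => by positivity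
  have hEM : ∀ n : ℕ, ‖ε • perp (E (n * Δt, xn n))‖ ≤ ε * M := fun n => by
    rw [norm_smul, norm_perp, Real.norm_of_nonneg hε.le]
    exact mul_le_mul_of_nonneg_left (hE.norm_le _ (ht n)) hε.le
  -- The velocity is one index ahead of the field, matching the contraction. Passing from `a n` to
  -- `a (n + 1)` then costs only the change of the field, whose position increment involves `vn (n +
  -- 1)`, already controlled by `a n`.
  set a : ℕ → ℝ := fun n => ‖vn (n + 1) + ε • perp (E (n * Δt, xn n))‖ with ha
  have hva : ∀ n, ‖vn (n + 1)‖ ≤ a n + ε * M := fun n => by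
    have := norm_sub_le (vn (n + 1) + ε • perp (E (n * Δt, xn n))) (ε • perp (E (n * Δt, xn n)))
    rw [add_sub_cancel_right] at this
    exact this.trans (add_le_add_right (hEM n) _)
  have h0 : a 0 ≤ ‖v₀‖ + ε * M := by
    refine (h.norm_add_perp_le hε hΔ 0).trans ((norm_add_le _ _).trans ?_)
    rw [h.init_v]
    exact add_le_add_right (hEM 0) _
  have hstep : ∀ n, a (n + 1) ≤ (1 + K * Δt) * a n +
      Δt * (ε * (L + K * M) * Real.exp (K * ((n + 1 : ℕ) * Δt))) := by
    intro n
    have h1 := h.norm_add_perp_le hε hΔ (n + 1)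
    have h2 : vn (n + 1) + ε • perp (E ((n + 1 : ℕ) * Δt, xn (n + 1))) =
        (vn (n + 1) + ε • perp (E (n * Δt, xn n))) +
        ε • perp (E ((n + 1 : ℕ) * Δt, xn (n + 1)) - E (n * Δt, xn n)) := by
      rw [perp_sub]; module
    have h3 := hE.norm_sub_le (xn (n + 1)) (xn n) (ht n) (ht (n + 1))
    rw [h.x_succ hΔ n, add_sub_cancel_left, norm_smul, ← h.x_succ hΔ n,
      Real.norm_of_nonneg (by positivity), show ((n + 1 : ℕ) : ℝ) * Δt - n * Δt = Δt by
        push_cast; ring, abs_of_pos hΔ] at h3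
    have h4 : a (n + 1) ≤ a n + ε * (L * Δt + K * (Δt / ε * ‖vn (n + 1)‖)) := by
      refine h1.trans ?_
      rw [h2]
      refine (norm_add_le _ _).trans (add_le_add_right ?_ _)
      rw [norm_smul, norm_perp, Real.norm_of_nonneg hε.le]
      exact mul_le_mul_of_nonneg_left h3 hε.le
    have h5 : ε * (L * Δt + K * (Δt / ε * ‖vn (n + 1)‖)) =
        ε * L * Δt + K * Δt * ‖vn (n + 1)‖ := by field_simp
    have h6 : K * Δt * ‖vn (n + 1)‖ ≤ K * Δt * (a n + ε * M) :=
      mul_le_mul_of_nonneg_left (hva n) (by positivity)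
    have h7 : Δt * (ε * (L + K * M)) ≤
        Δt * (ε * (L + K * M) * Real.exp (K * ((n + 1 : ℕ) * Δt))) := by
      refine mul_le_mul_of_nonneg_left (le_mul_of_one_le_right (by positivity) ?_) hΔ.le
      exact Real.one_le_exp (by positivity)
    linarith
  cases n with
  | zero =>
    rw [h.init_v]
    simp only [velocityFactor, Nat.cast_zero, zero_mul, mul_zero, Real.exp_zero, mul_one, add_zero]
    have : 0 ≤ ε * (2 * M) := by positivity
    linarith
  | succ n =>
    have h1 := discrete_gronwall (N := n) hK le_rfl hΔ.le (by positivity) (by positivity) h0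
      (fun k _ => hstep k) n le_rfl
    have h2 : ε * M ≤ ε * M * Real.exp (K * (n * Δt)) :=
      le_mul_of_one_le_right (by positivity) (Real.one_le_exp (by positivity))
    have hle : (n : ℝ) * Δt ≤ (n + 1 : ℕ) * Δt := by push_cast; linarith
    calc ‖vn (n + 1)‖ ≤ (‖v₀‖ + ε * M + n * Δt * (ε * (L + K * M))) * Real.exp (K * (n * Δt)) +
          ε * M * Real.exp (K * (n * Δt)) := (hva n).trans (add_le_add h1 h2)
      _ = velocityFactor M L K ε v₀ (n * Δt) * Real.exp (K * (n * Δt)) := by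
          unfold velocityFactor; ring
      _ ≤ _ := by
          have := hE.velocityFactor_mono (v₀ := v₀) hε hle
          have := hE.velocityFactor_nonneg (v₀ := v₀) hε (ht (n + 1))
          gcongr

/-! ### Velocity bound for the trajectories -/

section Trajectory

variable {x v : ℝ → Plane}

lemma IsTrajectory.continuousOn_x (h : IsTrajectory E ε x₀ v₀ x v) : ContinuousOn x (Ici 0) :=
  fun t ht => (h.deriv_x t ht).continuousWithinAt

lemma IsTrajectory.continuousOn_v (h : IsTrajectory E ε x₀ v₀ x v) : ContinuousOn v (Ici 0) :=
  fun t ht => (h.deriv_v t ht).continuousWithinAt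

lemma IsLipschitzField.continuousOn (hE : IsLipschitzField E M L K) :
    ContinuousOn E (Ici 0 ×ˢ univ) := by
  intro p hp
  rw [ContinuousWithinAt, tendsto_iff_norm_sub_tendsto_zero]
  have h : Tendsto (fun q : ℝ × Plane => L * |q.1 - p.1| + K * ‖q.2 - p.2‖)
      (𝓝[Ici 0 ×ˢ univ] p) (𝓝 (L * |p.1 - p.1| + K * ‖p.2 - p.2‖)) :=
    (Continuous.tendsto (by fun_prop) p).mono_left nhdsWithin_le_nhds
  simp only [sub_self, abs_zero, norm_zero, mul_zero, add_zero] at h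
  refine squeeze_zero' (Eventually.of_forall fun _ => norm_nonneg _) ?_ h
  filter_upwards [self_mem_nhdsWithin] with q hq
  exact hE.norm_sub_le q.2 p.2 hp.1 hq.1

lemma IsTrajectory.continuousOn_field (h : IsTrajectory E ε x₀ v₀ x v)
    (hE : IsLipschitzField E M L K) : ContinuousOn (fun t => E (t, x t)) (Ici 0) :=
  hE.continuousOn.comp (continuousOn_id.prodMk h.continuousOn_x) fun _ ht => ⟨ht, mem_univ _⟩

lemma norm_add_smul_neg_perp_le {c d : ℝ} (w : Plane) :
    ‖w + d • (-(c • perp w))‖ ≤ ‖w‖ + d * (d * c ^ 2 * ‖w‖) := by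
  have h := norm_add_smul_perp_le (-(d * c)) w
  calc _ = ‖w + (-(d * c)) • perp w‖ := by congr 1; module
    _ ≤ _ := h
    _ = _ := by ring

/-- The upper right Dini derivative of `‖v + ε E^⊥‖` is at most `ε L + K ‖v‖`. -/
lemma IsTrajectory.frequently_slope_lt (h : IsTrajectory E ε x₀ v₀ x v)
    (hE : IsLipschitzField E M L K) (hε : 0 < ε) {t r : ℝ} (ht : 0 ≤ t)
    (hr : ε * L + K * ‖v t‖ < r) :
    ∃ᶠ z in 𝓝[>] t, (z - t)⁻¹ * (‖v z + ε • perp (E (z, x z))‖ -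
      ‖v t + ε • perp (E (t, x t))‖) < r := by
  set w := v t + ε • perp (E (t, x t)) with hw
  set c := (ε ^ 2)⁻¹ with hc
  set v' := ε⁻¹ • (E (t, x t) - ε⁻¹ • perp (v t)) with hv'
  -- In terms of `w` the velocity equation is a pure rotation, so the large factor `c` affects the
  -- norm only at second order in `z - t`.
  have hv'w : v' = -(c • perp w) := by
    rw [hv', hw, hc, perp_add, perp_smul, perp_perp]
    match_scalars <;> field_simp
  have hsub : Ioi t ⊆ Ici 0 := fun z hz => ht.trans (mem_Ioi.1 hz).le
  have hdx := (hasDerivWithinAt_iff_tendsto_slope' self_notMem_Ioi).1 ((h.deriv_x t ht).mono hsub)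
  have hdv := (hasDerivWithinAt_iff_tendsto_slope' self_notMem_Ioi).1 ((h.deriv_v t ht).mono hsub)
  have hz : Tendsto (fun z => (z - t) * c ^ 2 * ‖w‖) (𝓝[>] t) (𝓝 ((t - t) * c ^ 2 * ‖w‖)) :=
    (Continuous.tendsto (by fun_prop) t).mono_left nhdsWithin_le_nhds
  have hlim : Tendsto (fun z => ‖slope v t z - v'‖ + (z - t) * c ^ 2 * ‖w‖ +
      (ε * L + ε * K * ‖slope x t z‖)) (𝓝[>] t)
      (𝓝 (‖v' - v'‖ + (t - t) * c ^ 2 * ‖w‖ + (ε * L + ε * K * ‖ε⁻¹ • v t‖))) :=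
    (((hdv.sub_const v').norm).add hz).add ((hdx.norm.const_mul (ε * K)).const_add (ε * L))
  have hval : ‖v' - v'‖ + (t - t) * c ^ 2 * ‖w‖ + (ε * L + ε * K * ‖ε⁻¹ • v t‖) =
      ε * L + K * ‖v t‖ := by
    rw [norm_smul, norm_inv, Real.norm_of_nonneg hε.le, sub_self, sub_self, norm_zero]
    field_simp
    ring
  rw [hval] at hlim
  refine Eventually.frequently ?_
  filter_upwards [hlim.eventually_lt_const hr, self_mem_nhdsWithin] with z hzr hzt
  refine lt_of_le_of_lt ?_ hzr
  have hd : 0 < z - t := sub_pos.2 hzt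
  have hsv : v z = v t + (z - t) • slope v t z := by
    rw [sub_smul_slope]; simp
  have hsx : x z - x t = (z - t) • slope x t z := by
    rw [sub_smul_slope]; simp
  have hEz := hE.norm_sub_le (x z) (x t) ht (hsub hzt)
  rw [hsx, norm_smul, Real.norm_of_nonneg hd.le, abs_of_pos hd] at hEz
  have e1 : v z + ε • perp (E (z, x z)) = (w + (z - t) • (-(c • perp w))) +
      (z - t) • (slope v t z - v') + ε • perp (E (z, x z) - E (t, x t)) := by
    rw [hsv, ← hv'w, hw, perp_sub]; module
  have e2 : ‖v z + ε • perp (E (z, x z))‖ ≤ ‖w‖ + (z - t) * ((z - t) * c ^ 2 * ‖w‖) +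
      (z - t) * ‖slope v t z - v'‖ +
      ε * (L * (z - t) + K * ((z - t) * ‖slope x t z‖)) := by
    rw [e1]
    refine (norm_add₃_le).trans ?_
    gcongr
    · exact norm_add_smul_neg_perp_le w
    · rw [norm_smul, Real.norm_of_nonneg hd.le]
    · rw [norm_smul, norm_perp, Real.norm_of_nonneg hε.le]
      gcongr
  rw [inv_mul_le_iff₀ hd]
  linarith

/-- `E` is only Lipschitz, so `v + ε E^⊥` need not be differentiable; Gronwall is applied to its
norm through the Dini derivative bound. -/
lemma IsTrajectory.norm_le (h : IsTrajectory E ε x₀ v₀ x v)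
    (hE : IsLipschitzField E M L K) (hε : 0 < ε) {t : ℝ} (ht : 0 ≤ t) :
    ‖v t‖ ≤ velocityFactor M L K ε v₀ t * Real.exp (K * t) := by
  have hM := hE.bound_nonneg
  have hL := hE.time_nonneg
  have hK := hE.space_nonneg
  have hEM : ∀ s, 0 ≤ s → ‖ε • perp (E (s, x s))‖ ≤ ε * M := fun s hs => by
    rw [norm_smul, norm_perp, Real.norm_of_nonneg hε.le]
    exact mul_le_mul_of_nonneg_left (hE.norm_le _ hs) hε.le
  have hva : ∀ s, 0 ≤ s → ‖v s‖ ≤ ‖v s + ε • perp (E (s, x s))‖ + ε * M := fun s hs => by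
    have := norm_sub_le (v s + ε • perp (E (s, x s))) (ε • perp (E (s, x s)))
    rw [add_sub_cancel_right] at this
    exact this.trans (add_le_add_right (hEM s hs) _)
  have hcont : ContinuousOn (fun s => ‖v s + ε • perp (E (s, x s))‖) (Icc 0 t) := by
    have h1 : ContinuousOn (fun s => v s + ε • perpCLM (E (s, x s))) (Ici 0) :=
      h.continuousOn_v.add
        ((perpCLM.continuous.comp_continuousOn (h.continuousOn_field hE)).const_smul ε)
    exact h1.norm.mono Icc_subset_Ici_self
  have h1 := le_gronwallBound_of_liminf_deriv_right_le
    (f' := fun s => ε * L + K * ‖v s‖) (δ := ‖v₀‖ + ε * M) (K := K) (ε := ε * (L + K * M)) hcont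
    (fun s hs r hr => h.frequently_slope_lt hE hε hs.1 hr)
    (by
      rw [h.init_v]
      refine (norm_add_le _ _).trans (add_le_add_right ?_ _)
      exact hEM 0 le_rfl)
    (fun s hs => by
      have := mul_le_mul_of_nonneg_left (hva s hs.1) hK
      linarith) t ⟨ht, le_rfl⟩
  rw [sub_zero] at h1
  have h2 := h1.trans (gronwallBound_le hK (by positivity))
  have h3 : ε * M ≤ ε * M * Real.exp (K * t) :=
    le_mul_of_one_le_right (by positivity) (Real.one_le_exp (by positivity))
  calc ‖v t‖ ≤ _ := (hva t ht).trans (add_le_add h2 h3)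
    _ = _ := by unfold velocityFactor; ring

lemma IsTrajectory.deriv_guidingCenter (h : IsTrajectory E ε x₀ v₀ x v) (hε : 0 < ε) {t : ℝ}
    (ht : 0 ≤ t) :
    HasDerivWithinAt (fun s => guidingCenter ε (x s) (v s)) (-perp (E (t, x t))) (Ici 0) t := by
  have h1 := (h.deriv_x t ht).sub ((hasDerivWithinAt_perp (h.deriv_v t ht)).const_smul ε)
  refine h1.congr_deriv ?_
  rw [perp_smul, perp_sub, perp_smul, perp_perp]
  match_scalars <;> field_simp
  ring

/-- A mean value inequality on `[a, b] ⊆ [0, ∞)`. -/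
lemma norm_sub_le_of_hasDerivWithinAt_Ici {f f' : ℝ → Plane} {a b C : ℝ} (ha : 0 ≤ a) (hab : a ≤ b)
    (hf : ∀ t, 0 ≤ t → HasDerivWithinAt f (f' t) (Ici 0) t)
    (hC : ∀ t ∈ Icc a b, ‖f' t‖ ≤ C) : ‖f b - f a‖ ≤ C * (b - a) :=
  norm_image_sub_le_of_norm_deriv_right_le_segment
    (fun t ht => (hf t (ha.trans ht.1)).continuousWithinAt.mono
      fun _ hs => ha.trans hs.1)
    (fun t ht => (hf t (ha.trans ht.1)).mono (Ici_subset_Ici.2 (ha.trans ht.1)))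
    (fun t ht => hC t ⟨ht.1, ht.2.le⟩) b ⟨hab, le_rfl⟩

lemma IsTrajectory.norm_x_sub_le (h : IsTrajectory E ε x₀ v₀ x v) (hε : 0 < ε) {a b V : ℝ}
    (ha : 0 ≤ a) (hab : a ≤ b) (hV : ∀ t ∈ Icc a b, ‖v t‖ ≤ V) :
    ‖x b - x a‖ ≤ V / ε * (b - a) := by
  refine norm_sub_le_of_hasDerivWithinAt_Ici ha hab h.deriv_x fun t ht => ?_
  rw [norm_smul, norm_inv, Real.norm_of_nonneg hε.le, inv_mul_eq_div]
  exact div_le_div_of_nonneg_right (hV t ht) hε.le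

lemma IsTrajectory.norm_v_sub_le (h : IsTrajectory E ε x₀ v₀ x v) (hE : IsLipschitzField E M L K)
    (hε : 0 < ε) {a b V : ℝ}
    (ha : 0 ≤ a) (hab : a ≤ b) (hV : ∀ t ∈ Icc a b, ‖v t‖ ≤ V) :
    ‖v b - v a‖ ≤ (M + V / ε) / ε * (b - a) := by
  refine norm_sub_le_of_hasDerivWithinAt_Ici ha hab h.deriv_v fun t ht => ?_
  rw [norm_smul, norm_inv, Real.norm_of_nonneg hε.le, inv_mul_eq_div]
  refine div_le_div_of_nonneg_right ((norm_sub_le _ _).trans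
    (add_le_add (hE.norm_le _ (ha.trans ht.1)) ?_)) hε.le
  rw [norm_smul, norm_inv, Real.norm_of_nonneg hε.le, inv_mul_eq_div, norm_perp]
  exact div_le_div_of_nonneg_right (hV t ht) hε.le

lemma IsTrajectory.norm_guidingCenter_sub_le (h : IsTrajectory E ε x₀ v₀ x v)
    (hE : IsLipschitzField E M L K) (hε : 0 < ε) {a b : ℝ} (ha : 0 ≤ a) (hab : a ≤ b) :
    ‖guidingCenter ε (x b) (v b) - guidingCenter ε (x a) (v a)‖ ≤ M * (b - a) := by
  refine norm_sub_le_of_hasDerivWithinAt_Ici (f := fun s => guidingCenter ε (x s) (v s))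
    (f' := fun s => -perp (E (s, x s))) ha hab (fun t ht => h.deriv_guidingCenter hε ht)
    fun t ht => ?_
  rw [norm_neg, norm_perp]
  exact hE.norm_le _ (ha.trans ht.1)

end Trajectory

end

/-! ### First-order error estimates. -/

section

variable {E : ℝ × Plane → Plane} {M L K ε Δt : ℝ} {x₀ v₀ : Plane} {x v : ℝ → Plane}
  {xn vn : ℕ → Plane}

lemma cast_succ_mul_sub (n : ℕ) (h : ℝ) : ((n + 1 : ℕ) : ℝ) * h - n * h = h := by
  push_cast; ring

lemma IsTrajectory.norm_guidingCenter_step_le (h : IsTrajectory E ε x₀ v₀ x v) (hε : 0 < ε)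
    {a b C : ℝ} (ha : 0 ≤ a) (hab : a ≤ b) (e : Plane)
    (hC : ∀ s ∈ Icc a b, ‖E (s, x s) - e‖ ≤ C) :
    ‖guidingCenter ε (x b) (v b) - guidingCenter ε (x a) (v a) + (b - a) • perp e‖ ≤
      C * (b - a) := by
  have h1 := norm_sub_le_of_hasDerivWithinAt_Ici
    (f := fun s => guidingCenter ε (x s) (v s) + s • perp e)
    (f' := fun s => -perp (E (s, x s)) + (1 : ℝ) • perp e) (C := C) ha hab
    (fun t ht => (h.deriv_guidingCenter hε ht).add ((hasDerivWithinAt_id t _).smul_const _))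
    (fun s hs => by
      rw [show -perp (E (s, x s)) + (1 : ℝ) • perp e = -perp (E (s, x s) - e) by
        rw [perp_sub]; module, norm_neg, norm_perp]
      exact hC s hs)
  refine le_trans (le_of_eq ?_) h1
  congr 1
  module

/-- Consistency error of the implicit step: the rotation term is frozen at the right endpoint `b`,
as in the scheme. -/
lemma IsTrajectory.norm_velocity_step_le (h : IsTrajectory E ε x₀ v₀ x v) (hε : 0 < ε)
    {a b C R : ℝ} (ha : 0 ≤ a) (hab : a ≤ b) (e : Plane)
    (hC : ∀ s ∈ Icc a b, ‖E (s, x s) - e‖ ≤ C) (hR : ∀ s ∈ Icc a b, ‖v b - v s‖ ≤ R) :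
    ‖ε • (v b - v a) - (b - a) • (e - ε⁻¹ • perp (v b))‖ ≤ (C + R / ε) * (b - a) := by
  have h1 := norm_sub_le_of_hasDerivWithinAt_Ici
    (f := fun s => ε • v s - s • (e - ε⁻¹ • perp (v b)))
    (f' := fun s => ε • (ε⁻¹ • (E (s, x s) - ε⁻¹ • perp (v s))) -
      (1 : ℝ) • (e - ε⁻¹ • perp (v b))) (C := C + R / ε) ha hab
    (fun t ht => ((h.deriv_v t ht).const_smul ε).sub ((hasDerivWithinAt_id t _).smul_const _))
    (fun s hs => by
      rw [show ε • (ε⁻¹ • (E (s, x s) - ε⁻¹ • perp (v s))) -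
        (1 : ℝ) • (e - ε⁻¹ • perp (v b)) = (E (s, x s) - e) + ε⁻¹ • perp (v b - v s) by
          rw [perp_sub]; match_scalars <;> field_simp]
      refine (norm_add_le _ _).trans (add_le_add (hC s hs) ?_)
      rw [norm_smul, norm_inv, Real.norm_of_nonneg hε.le, inv_mul_eq_div, norm_perp]
      exact div_le_div_of_nonneg_right (hR s hs) hε.le)
  refine le_trans (le_of_eq ?_) h1
  congr 1
  module

lemma norm_sub_le_guidingCenter (hε : 0 < ε) (x y v w : Plane) :
    ‖x - y‖ ≤ ‖guidingCenter ε x v - guidingCenter ε y w‖ + ε * ‖v - w‖ := by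
  have h : x - y = (guidingCenter ε x v - guidingCenter ε y w) + ε • perp (v - w) := by
    unfold guidingCenter; rw [perp_sub]; module
  rw [h]
  refine (norm_add_le _ _).trans (add_le_add_right ?_ _)
  rw [norm_smul, norm_perp, Real.norm_of_nonneg hε.le]

/-- The polynomial prefactor is taken at a fixed horizon `T`, while the exponential keeps the
current time `t`. The Gronwall lemmas need sources of this shape to avoid multiplying exponentials.
-/
lemma IsTrajectory.norm_le_of_le (h : IsTrajectory E ε x₀ v₀ x v)
    (hE : IsLipschitzField E M L K) (hε : 0 < ε) {s t T : ℝ} (hs : 0 ≤ s) (hst : s ≤ t)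
    (htT : t ≤ T) : ‖v s‖ ≤ velocityFactor M L K ε v₀ T * Real.exp (K * t) := by
  have := hE.space_nonneg
  have := hE.velocityFactor_mono (v₀ := v₀) hε (hst.trans htT)
  have := hE.velocityFactor_nonneg (v₀ := v₀) hε (hs.trans (hst.trans htT))
  refine (h.norm_le hE hε hs).trans ?_
  gcongr

lemma IsScheme.norm_le_of_le (h : IsScheme E ε Δt x₀ v₀ xn vn)
    (hE : IsLipschitzField E M L K) (hε : 0 < ε) (hΔ : 0 < Δt) {n : ℕ} {t T : ℝ}
    (hst : n * Δt ≤ t) (htT : t ≤ T) :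
    ‖vn n‖ ≤ velocityFactor M L K ε v₀ T * Real.exp (K * t) := by
  have := hE.space_nonneg
  have := hE.velocityFactor_mono (v₀ := v₀) hε (hst.trans htT)
  have hs : 0 ≤ (n : ℝ) * Δt := by positivity
  have := hE.velocityFactor_nonneg (v₀ := v₀) hε (hs.trans (hst.trans htT))
  refine (h.norm_le hE hε hΔ n).trans ?_
  gcongr

/-- Error estimate of classical type, with constants which degenerate as `ε` tends to `0`. -/
theorem classical_error (hE : IsLipschitzField E M L K) (hε : 0 < ε) (hΔ : 0 < Δt)
    (ht : IsTrajectory E ε x₀ v₀ x v) (hs : IsScheme E ε Δt x₀ v₀ xn vn) (N : ℕ) :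
    ‖guidingCenter ε (xn N) (vn N) - guidingCenter ε (x (N * Δt)) (v (N * Δt))‖ +
      ε * ‖vn N - v (N * Δt)‖ ≤
    N * Δt * (Δt * (2 * L + 2 * K * velocityFactor M L K ε v₀ (N * Δt) / ε + M / ε ^ 2 +
      velocityFactor M L K ε v₀ (N * Δt) / ε ^ 3)) * Real.exp (2 * K * (N * Δt)) := by
  have hM := hE.bound_nonneg
  have hL := hE.time_nonneg
  have hK := hE.space_nonneg
  have hN : 0 ≤ (N : ℝ) * Δt := by positivity
  set A := velocityFactor M L K ε v₀ (N * Δt) with hA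
  have hA0 : 0 ≤ A := hE.velocityFactor_nonneg hε hN
  set S : ℕ → ℝ := fun n =>
    ‖guidingCenter ε (xn n) (vn n) - guidingCenter ε (x (n * Δt)) (v (n * Δt))‖ +
      ε * ‖vn n - v (n * Δt)‖ with hS
  have hstep : ∀ n < N, S (n + 1) ≤ (1 + 2 * K * Δt) * S n +
      Δt * (Δt * (2 * L + 2 * K * A / ε + M / ε ^ 2 + A / ε ^ 3) *
        Real.exp (2 * K * ((n + 1 : ℕ) * Δt))) := by
    intro n hn
    set a : ℝ := n * Δt with ha_def
    set b : ℝ := (n + 1 : ℕ) * Δt with hb_def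
    have hba : b - a = Δt := cast_succ_mul_sub n Δt
    have ha : 0 ≤ a := by positivity
    have hab : a ≤ b := by linarith
    have hbN : b ≤ N * Δt := by
      have : ((n + 1 : ℕ) : ℝ) ≤ N := by exact_mod_cast hn
      exact mul_le_mul_of_nonneg_right this hΔ.le
    set V := A * Real.exp (K * b) with hV_def
    have hV0 : 0 ≤ V := by positivity
    have hV : ∀ s, a ≤ s → s ≤ b → ‖v s‖ ≤ V := fun s hs1 hs2 =>
      ht.norm_le_of_le hE hε (ha.trans hs1) hs2 hbN
    have hSn : ‖x a - xn n‖ ≤ S n := by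
      rw [norm_sub_rev]; exact norm_sub_le_guidingCenter hε _ _ _ _
    set e := E (a, xn n) with he
    -- The field error contains `K * S n` and enters both the guiding center and the velocity
    -- update; hence the rate `2 * K` in the recursion.
    set C := L * Δt + K * (V / ε * Δt + S n) with hC_def
    have hC : ∀ s ∈ Icc a b, ‖E (s, x s) - e‖ ≤ C := by
      intro s hs'
      refine (hE.norm_sub_le _ _ ha (ha.trans hs'.1)).trans ?_
      have h1 : |s - a| ≤ Δt := by rw [abs_of_nonneg (by linarith [hs'.1])]; linarith [hs'.2]
      have h2 : ‖x s - xn n‖ ≤ V / ε * Δt + S n := by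
        have h3 := ht.norm_x_sub_le hε ha hs'.1 (fun r hr => hV r hr.1 (hr.2.trans hs'.2))
        have h4 : V / ε * (s - a) ≤ V / ε * Δt :=
          mul_le_mul_of_nonneg_left (by linarith [hs'.2]) (by positivity)
        calc ‖x s - xn n‖ = ‖(x s - x a) + (x a - xn n)‖ := by congr 1; abel
          _ ≤ _ := (norm_add_le _ _).trans (add_le_add (h3.trans h4) hSn)
      exact add_le_add (mul_le_mul_of_nonneg_left h1 hL) (mul_le_mul_of_nonneg_left h2 hK)
    have hR : ∀ s ∈ Icc a b, ‖v b - v s‖ ≤ (M + V / ε) / ε * Δt := by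
      intro s hs'
      refine (ht.norm_v_sub_le hE hε (ha.trans hs'.1) hs'.2
        (fun r hr => hV r (hs'.1.trans hr.1) hr.2)).trans ?_
      exact mul_le_mul_of_nonneg_left (by linarith [hs'.1]) (by positivity)
    have hy := ht.norm_guidingCenter_step_le hε ha hab e hC
    have hv := ht.norm_velocity_step_le hε ha hab e hC hR
    rw [hba] at hy hv
    have hy' : ‖guidingCenter ε (xn (n + 1)) (vn (n + 1)) - guidingCenter ε (x b) (v b)‖ ≤
        ‖guidingCenter ε (xn n) (vn n) - guidingCenter ε (x a) (v a)‖ + C * Δt := by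
      rw [hs.guidingCenter_succ hε hΔ n]
      refine le_trans (le_of_eq ?_) ((norm_sub_le _ _).trans (add_le_add_right hy _))
      congr 1
      module
    have hv' : ε * ‖vn (n + 1) - v b‖ ≤ ε * ‖vn n - v a‖ +
        (C + (M + V / ε) / ε * Δt / ε) * Δt := by
      have h1 := norm_le_norm_add_smul_perp (Δt / ε ^ 2) (vn (n + 1) - v b)
      have h2 : ε • ((vn (n + 1) - v b) + (Δt / ε ^ 2) • perp (vn (n + 1) - v b)) =
          ε • (vn n - v a) - (ε • (v b - v a) - Δt • (e - ε⁻¹ • perp (v b))) := by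
        have h3 : (vn (n + 1) - v b) + (Δt / ε ^ 2) • perp (vn (n + 1) - v b) =
            (vn n + (Δt / ε) • e) - (v b + (Δt / ε ^ 2) • perp (v b)) := by
          rw [he, ha_def, ← hs.v_succ hε hΔ n, perp_sub]; module
        rw [h3]
        match_scalars <;> field_simp
        ring
      calc ε * ‖vn (n + 1) - v b‖ ≤
            ε * ‖(vn (n + 1) - v b) + (Δt / ε ^ 2) • perp (vn (n + 1) - v b)‖ :=
            mul_le_mul_of_nonneg_left h1 hε.le
        _ = ‖ε • ((vn (n + 1) - v b) + (Δt / ε ^ 2) • perp (vn (n + 1) - v b))‖ := by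
            rw [norm_smul, Real.norm_of_nonneg hε.le]
        _ ≤ ‖ε • (vn n - v a)‖ + (C + (M + V / ε) / ε * Δt / ε) * Δt := by
            rw [h2]; exact (norm_sub_le _ _).trans (add_le_add_right hv _)
        _ = _ := by rw [norm_smul, Real.norm_of_nonneg hε.le]
    have hexp : Real.exp (K * b) ≤ Real.exp (2 * K * b) :=
      Real.exp_le_exp.2 (by nlinarith [mul_nonneg hK (ha.trans hab)])
    have hexp1 : 1 ≤ Real.exp (2 * K * b) := Real.one_le_exp (by
      have := ha.trans hab; positivity)
    have hbound : 2 * L + 2 * K * V / ε + M / ε ^ 2 + V / ε ^ 3 ≤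
        (2 * L + 2 * K * A / ε + M / ε ^ 2 + A / ε ^ 3) * Real.exp (2 * K * b) := by
      have h1 : 2 * L ≤ 2 * L * Real.exp (2 * K * b) :=
        le_mul_of_one_le_right (by positivity) hexp1
      have h2 : M / ε ^ 2 ≤ M / ε ^ 2 * Real.exp (2 * K * b) :=
        le_mul_of_one_le_right (by positivity) hexp1
      have h3 : V ≤ A * Real.exp (2 * K * b) := mul_le_mul_of_nonneg_left hexp hA0
      have h4 : 2 * K * V / ε ≤ 2 * K * (A * Real.exp (2 * K * b)) / ε := by gcongr
      have h5 : V / ε ^ 3 ≤ A * Real.exp (2 * K * b) / ε ^ 3 := by gcongr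
      calc _ ≤ _ := add_le_add (add_le_add (add_le_add h1 h4) h2) h5
        _ = _ := by ring
    have hSa : S n = ‖guidingCenter ε (xn n) (vn n) - guidingCenter ε (x a) (v a)‖ +
        ε * ‖vn n - v a‖ := rfl
    calc S (n + 1) ≤ _ := add_le_add hy' hv'
      _ = S n + (C * Δt + (C + (M + V / ε) / ε * Δt / ε) * Δt) := by rw [hSa]; ring
      _ = (1 + 2 * K * Δt) * S n + Δt * (Δt * (2 * L + 2 * K * V / ε + M / ε ^ 2 + V / ε ^ 3)) := by
          rw [hC_def]; field_simp; ring
      _ ≤ (1 + 2 * K * Δt) * S n + Δt * (Δt * ((2 * L + 2 * K * A / ε + M / ε ^ 2 + A / ε ^ 3) *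
            Real.exp (2 * K * b))) := by gcongr
      _ = _ := by ring
  have h0 : S 0 ≤ 0 := by
    simp [hS, ht.init_x, ht.init_v, hs.init_x, hs.init_v]
  have := discrete_gronwall (by positivity) le_rfl hΔ.le (by positivity) le_rfl h0 hstep N le_rfl
  rwa [zero_add] at this

/-- Error estimate for the guiding center by comparison with the drift, uniform in `ε`. -/
theorem drift_error (hE : IsLipschitzField E M L K) (hε : 0 < ε) (hΔ : 0 < Δt)
    (ht : IsTrajectory E ε x₀ v₀ x v) (hs : IsScheme E ε Δt x₀ v₀ xn vn) (N : ℕ) :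
    ‖guidingCenter ε (xn N) (vn N) - guidingCenter ε (x (N * Δt)) (v (N * Δt))‖ ≤
    N * Δt * ((L + K * M) * Δt + 2 * ε * K * velocityFactor M L K ε v₀ (N * Δt)) *
      Real.exp (2 * K * (N * Δt)) := by
  have hM := hE.bound_nonneg
  have hL := hE.time_nonneg
  have hK := hE.space_nonneg
  have hN : 0 ≤ (N : ℝ) * Δt := by positivity
  set A := velocityFactor M L K ε v₀ (N * Δt) with hA
  have hA0 : 0 ≤ A := hE.velocityFactor_nonneg hε hN
  set S : ℕ → ℝ := fun n =>
    ‖guidingCenter ε (xn n) (vn n) - guidingCenter ε (x (n * Δt)) (v (n * Δt))‖ with hS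
  have hstep : ∀ n < N, S (n + 1) ≤ (1 + K * Δt) * S n +
      Δt * (((L + K * M) * Δt + 2 * ε * K * A) * Real.exp (2 * K * ((n + 1 : ℕ) * Δt))) := by
    intro n hn
    set a : ℝ := n * Δt with ha_def
    set b : ℝ := (n + 1 : ℕ) * Δt with hb_def
    have hba : b - a = Δt := cast_succ_mul_sub n Δt
    have ha : 0 ≤ a := by positivity
    have hab : a ≤ b := by linarith
    have hbN : b ≤ N * Δt := by
      have : ((n + 1 : ℕ) : ℝ) ≤ N := by exact_mod_cast hn
      exact mul_le_mul_of_nonneg_right this hΔ.le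
    set V := A * Real.exp (K * b) with hV_def
    have hV0 : 0 ≤ V := by positivity
    have hC : ∀ s ∈ Icc a b, ‖E (s, x s) - E (a, xn n)‖ ≤
        L * Δt + K * (M * Δt + S n + ε * (V + V)) := by
      intro s hs'
      refine (hE.norm_sub_le _ _ ha (ha.trans hs'.1)).trans ?_
      have h1 : |s - a| ≤ Δt := by rw [abs_of_nonneg (by linarith [hs'.1])]; linarith [hs'.2]
      have h2 : ‖x s - xn n‖ ≤ M * Δt + S n + ε * (V + V) := by
        refine (norm_sub_le_guidingCenter hε _ _ (v s) (vn n)).trans ?_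
        have h3 := ht.norm_guidingCenter_sub_le hE hε ha hs'.1
        have h4 : M * (s - a) ≤ M * Δt := mul_le_mul_of_nonneg_left (by linarith [hs'.2]) hM
        -- The fast velocities are not compared, only bounded; the factor `ε` in front of this term
        -- makes that affordable.
        have h5 : ‖v s - vn n‖ ≤ V + V := (norm_sub_le _ _).trans
          (add_le_add (ht.norm_le_of_le hE hε (ha.trans hs'.1) hs'.2 hbN)
            (hs.norm_le_of_le hE hε hΔ hab hbN))
        have h6 : ‖guidingCenter ε (x a) (v a) - guidingCenter ε (xn n) (vn n)‖ ≤ S n := by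
          rw [norm_sub_rev]
        have h7 : ‖guidingCenter ε (x s) (v s) - guidingCenter ε (xn n) (vn n)‖ ≤
            M * Δt + S n := by
          rw [← sub_add_sub_cancel _ (guidingCenter ε (x a) (v a))]
          exact (norm_add_le _ _).trans (add_le_add (h3.trans h4) h6)
        gcongr
      gcongr
    have hy := ht.norm_guidingCenter_step_le hε ha hab _ hC
    rw [hba] at hy
    have hy' : S (n + 1) ≤ S n + (L * Δt + K * (M * Δt + S n + ε * (V + V))) * Δt := by
      simp only [hS]
      rw [hs.guidingCenter_succ hε hΔ n]
      refine le_trans (le_of_eq ?_) ((norm_sub_le _ _).trans (add_le_add_right hy _))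
      congr 1
      module
    have hexp : Real.exp (K * b) ≤ Real.exp (2 * K * b) :=
      Real.exp_le_exp.2 (by nlinarith [mul_nonneg hK (ha.trans hab)])
    have hexp1 : 1 ≤ Real.exp (2 * K * b) := Real.one_le_exp (by
      have := ha.trans hab; positivity)
    have hbound : (L + K * M) * Δt + 2 * ε * K * V ≤
        ((L + K * M) * Δt + 2 * ε * K * A) * Real.exp (2 * K * b) := by
      have h1 : (L + K * M) * Δt ≤ (L + K * M) * Δt * Real.exp (2 * K * b) :=
        le_mul_of_one_le_right (by positivity) hexp1
      have h3 : V ≤ A * Real.exp (2 * K * b) := mul_le_mul_of_nonneg_left hexp hA0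
      have h4 : 2 * ε * K * V ≤ 2 * ε * K * (A * Real.exp (2 * K * b)) := by gcongr
      linarith
    calc S (n + 1) ≤ _ := hy'
      _ = (1 + K * Δt) * S n + Δt * ((L + K * M) * Δt + 2 * ε * K * V) := by ring
      _ ≤ _ := by gcongr
  have h0 : S 0 ≤ 0 := by
    simp [hS, ht.init_x, ht.init_v, hs.init_x, hs.init_v]
  have := discrete_gronwall hK (by linarith) hΔ.le (by positivity) le_rfl h0 hstep N le_rfl
  rwa [zero_add] at this

end

/-! ### Averaging: the second-order estimate for the guiding center. -/

section

/-- Summation by parts for a slowly varying sequence of linear maps. -/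
lemma norm_sum_apply_sub_le {V W : Type*} [NormedAddCommGroup V] [NormedSpace ℝ V]
    [NormedAddCommGroup W] [NormedSpace ℝ W] (D : ℕ → V →L[ℝ] W) (u : ℕ → V) {K ρ U : ℝ}
    (n : ℕ) (hD : ∀ k, ‖D k‖ ≤ K) (hρ : ∀ k, ‖D (k + 1) - D k‖ ≤ ρ)
    (hu : ∀ k ≤ n, ‖u k‖ ≤ U) :
    ‖∑ k ∈ Finset.range n, D k (u (k + 1) - u k)‖ ≤ (2 * K + n * ρ) * U := by
  have key : ∑ k ∈ Finset.range n, D k (u (k + 1) - u k) =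
      D n (u n) - D 0 (u 0) - ∑ k ∈ Finset.range n, (D (k + 1) - D k) (u (k + 1)) := by
    rw [← Finset.sum_range_sub (fun k => D k (u k)), ← Finset.sum_sub_distrib]
    refine Finset.sum_congr rfl fun k _ => ?_
    rw [map_sub, sub_apply]
    abel
  have hD' : ∀ k ≤ n, ‖D k (u k)‖ ≤ K * U := fun k hk =>
    (D k).le_of_opNorm_le_of_le (hD k) (hu k hk)
  have hs : ‖∑ k ∈ Finset.range n, (D (k + 1) - D k) (u (k + 1))‖ ≤ n * (ρ * U) := by
    have h : ∀ k ∈ Finset.range n, ‖(D (k + 1) - D k) (u (k + 1))‖ ≤ ρ * U := fun k hk =>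
      (D (k + 1) - D k).le_of_opNorm_le_of_le (hρ k) (hu _ (Finset.mem_range.1 hk))
    exact (norm_sum_le_of_le _ h).trans_eq (by simp)
  rw [key]
  refine (norm_sub_le _ _).trans ((add_le_add ((norm_sub_le _ _).trans
    (add_le_add (hD' n le_rfl) (hD' 0 (Nat.zero_le n)))) hs).trans_eq ?_)
  ring

variable {E : ℝ × Plane → Plane} {D : ℝ × Plane → Plane →L[ℝ] Plane} {M L K Q ε Δt : ℝ}
  {x₀ v₀ : Plane} {x v : ℝ → Plane} {xn vn : ℕ → Plane}

lemma guidingCenter_add (ε : ℝ) (x v : Plane) : guidingCenter ε x v + ε • perp v = x := by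
  unfold guidingCenter; abel

lemma norm_smul_perp_le (hε : 0 < ε) {v : Plane} {V : ℝ} (hv : ‖v‖ ≤ V) :
    ‖ε • perp v‖ ≤ ε * V := by
  rw [norm_smul, norm_perp, Real.norm_of_nonneg hε.le]
  exact mul_le_mul_of_nonneg_left hv hε.le

/-- The remainder in the expansion of the field around the guiding center. -/
lemma IsLipschitzDeriv.norm_taylor_guidingCenter_le (hD : IsLipschitzDeriv E D K Q) (hε : 0 < ε)
    {t V : ℝ} (ht : 0 ≤ t) (x : Plane) {v : Plane} (hv : ‖v‖ ≤ V) :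
    ‖E (t, x) - E (t, guidingCenter ε x v) - D (t, guidingCenter ε x v) (ε • perp v)‖ ≤
      Q * (ε * V) ^ 2 := by
  have h := hD.taylor (guidingCenter ε x v) (ε • perp v) ht
  rw [guidingCenter_add] at h
  have := hD.nonneg
  have := norm_smul_perp_le hε hv
  refine h.trans ?_
  gcongr

/-- One step of the exact guiding center, up to a total difference. -/
lemma IsTrajectory.norm_guidingCenter_expansion_le (h : IsTrajectory E ε x₀ v₀ x v)
    (hE : IsLipschitzField E M L K) (hD : IsLipschitzDeriv E D K Q) (hε : 0 < ε) {a b V : ℝ}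
    (ha : 0 ≤ a) (hab : a ≤ b) (hV : ∀ s ∈ Icc a b, ‖v s‖ ≤ V) :
    ‖guidingCenter ε (x b) (v b) - guidingCenter ε (x a) (v a) +
        (b - a) • perp (E (a, guidingCenter ε (x a) (v a))) -
        perp (D (a, guidingCenter ε (x a) (v a)) (ε ^ 3 • v b - ε ^ 3 • v a))‖ ≤
      (Q * (ε * V) ^ 2 + Q * ((1 + M) * (b - a)) * (ε * V) + (L + K * M) * (b - a) +
        ε ^ 2 * (K * M)) * (b - a) := by
  have hM := hE.bound_nonneg
  have hL := hE.time_nonneg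
  have hK := hE.space_nonneg
  have hQ := hD.nonneg
  set y : ℝ → Plane := fun s => guidingCenter ε (x s) (v s) with hy
  set e := E (a, y a) with he
  set A := D (a, y a) with hA
  have hder : ∀ t, 0 ≤ t → HasDerivWithinAt (fun s => y s + s • perp e - perp (A (ε ^ 3 • v s)))
      (-perp (E (t, x t)) + (1 : ℝ) • perp e -
        perp (A (ε ^ 3 • (ε⁻¹ • (E (t, x t) - ε⁻¹ • perp (v t)))))) (Ici 0) t := fun t ht =>
    ((h.deriv_guidingCenter hε ht).add ((hasDerivWithinAt_id t _).smul_const _)).sub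
      (hasDerivWithinAt_perp
        (A.hasFDerivAt.comp_hasDerivWithinAt t ((h.deriv_v t ht).const_smul (ε ^ 3))))
  have h1 := norm_sub_le_of_hasDerivWithinAt_Ici ha hab hder
    (C := Q * (ε * V) ^ 2 + Q * ((1 + M) * (b - a)) * (ε * V) + (L + K * M) * (b - a) +
        ε ^ 2 * (K * M)) (fun s hs => by
      have hs0 := ha.trans hs.1
      have e1 : -perp (E (s, x s)) + (1 : ℝ) • perp e -
          perp (A (ε ^ 3 • (ε⁻¹ • (E (s, x s) - ε⁻¹ • perp (v s))))) =
          -perp ((E (s, x s) - E (s, y s) - D (s, y s) (ε • perp (v s))) +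
            (D (s, y s) - A) (ε • perp (v s)) + (E (s, y s) - e) + ε ^ 2 • A (E (s, x s))) := by
        -- This is the averaging identity `ε³ v' = ε² E - ε v^⊥`: subtracting the derivative of `A
        -- (ε³ v)` replaces the oscillating first-order term by one of size `ε²`.
        rw [show ε ^ 3 • (ε⁻¹ • (E (s, x s) - ε⁻¹ • perp (v s))) =
          ε ^ 2 • E (s, x s) - ε • perp (v s) by match_scalars <;> field_simp,
          map_sub, map_smul, sub_apply]
        simp only [perp_add, perp_sub, perp_smul]
        module
      rw [e1, norm_neg, norm_perp]
      have hsa : |s - a| ≤ b - a := by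
        rw [abs_of_nonneg (by linarith [hs.1])]; linarith [hs.2]
      have hys : ‖y s - y a‖ ≤ M * (b - a) :=
        (h.norm_guidingCenter_sub_le hE hε ha hs.1).trans
          (mul_le_mul_of_nonneg_left (by linarith [hs.2]) hM)
      have b1 := hD.norm_taylor_guidingCenter_le hε hs0 (x s) (hV s hs)
      have b2 : ‖(D (s, y s) - A) (ε • perp (v s))‖ ≤ Q * ((1 + M) * (b - a)) * (ε * V) := by
        refine (D (s, y s) - A).le_of_opNorm_le_of_le ?_ (norm_smul_perp_le hε (hV s hs))
        refine (hD.norm_sub_le _ _ ha hs0).trans (mul_le_mul_of_nonneg_left ?_ hQ)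
        linarith
      have b3 : ‖E (s, y s) - e‖ ≤ (L + K * M) * (b - a) := by
        refine (hE.norm_sub_le _ _ ha hs0).trans ?_
        have := mul_le_mul_of_nonneg_left hsa hL
        have := mul_le_mul_of_nonneg_left hys hK
        linarith
      have b4 : ‖ε ^ 2 • A (E (s, x s))‖ ≤ ε ^ 2 * (K * M) := by
        rw [norm_smul, Real.norm_of_nonneg (by positivity)]
        exact mul_le_mul_of_nonneg_left
          (A.le_of_opNorm_le_of_le (hD.norm_le _ ha) (hE.norm_le _ hs0)) (by positivity)
      exact (norm_add_le _ _).trans (add_le_add ((norm_add_le _ _).trans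
        (add_le_add ((norm_add_le _ _).trans (add_le_add b1 b2)) b3)) b4))
  refine le_trans (le_of_eq ?_) h1
  congr 1
  rw [map_sub, perp_sub]
  module

/-- One step of the numerical guiding center, up to a total difference. -/
lemma IsScheme.norm_guidingCenter_expansion_le (h : IsScheme E ε Δt x₀ v₀ xn vn)
    (hE : IsLipschitzField E M L K) (hD : IsLipschitzDeriv E D K Q) (hε : 0 < ε) (hΔ : 0 < Δt)
    {V : ℝ} (n : ℕ) (hV : ‖vn n‖ ≤ V) :
    ‖guidingCenter ε (xn (n + 1)) (vn (n + 1)) - guidingCenter ε (xn n) (vn n) +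
        Δt • perp (E (n * Δt, guidingCenter ε (xn n) (vn n))) -
        perp (D (n * Δt, guidingCenter ε (xn n) (vn n))
          ((ε ^ 3 • vn (n + 1) + (Δt * ε) • perp (vn (n + 1))) -
            (ε ^ 3 • vn n + (Δt * ε) • perp (vn n))))‖ ≤
      (Q * (ε * V) ^ 2 + ε ^ 2 * (K * M)) * Δt := by
  have ht : 0 ≤ (n : ℝ) * Δt := by positivity
  rw [h.guidingCenter_succ hε hΔ n]
  set y := guidingCenter ε (xn n) (vn n) with hy
  set A := D (n * Δt, y) with hA
  -- Discrete averaging identity. The explicit field sees `vn n` while the rotation is implicit in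
  -- `vn (n + 1)`; the correction `(Δt * ε) • perp` accounts for this shift of index.
  have e1 : (ε ^ 3 • vn (n + 1) + (Δt * ε) • perp (vn (n + 1))) -
      (ε ^ 3 • vn n + (Δt * ε) • perp (vn n)) =
      (ε ^ 2 * Δt) • E (n * Δt, xn n) - Δt • (ε • perp (vn n)) := by
    have h1 := congrArg (fun w => ε ^ 3 • w) (h.v_succ hε hΔ n)
    have h2 : ε ^ 3 • vn (n + 1) + (Δt * ε) • perp (vn (n + 1)) =
        ε ^ 3 • vn n + (ε ^ 2 * Δt) • E (n * Δt, xn n) := by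
      convert h1 using 1
      · match_scalars <;> field_simp
      · match_scalars <;> field_simp
    rw [h2]
    module
  rw [e1, map_sub, map_smul, map_smul A Δt]
  have e2 : y - Δt • perp (E (n * Δt, xn n)) - y + Δt • perp (E (n * Δt, y)) -
      perp ((ε ^ 2 * Δt) • A (E (n * Δt, xn n)) - Δt • A (ε • perp (vn n))) =
      -(Δt • perp ((E (n * Δt, xn n) - E (n * Δt, y) - A (ε • perp (vn n))) +
        ε ^ 2 • A (E (n * Δt, xn n)))) := by
    simp only [perp_add, perp_sub, perp_smul]
    module
  rw [e2, norm_neg, norm_smul, norm_perp, Real.norm_of_nonneg hΔ.le, mul_comm]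
  refine mul_le_mul_of_nonneg_right ((norm_add_le _ _).trans (add_le_add
    (hD.norm_taylor_guidingCenter_le hε ht (xn n) hV) ?_)) hΔ.le
  rw [norm_smul, Real.norm_of_nonneg (by positivity)]
  exact mul_le_mul_of_nonneg_left
    (A.le_of_opNorm_le_of_le (hD.norm_le _ ht) (hE.norm_le _ ht)) (by positivity)

/-- Second-order asymptotic error estimate for the guiding center, uniform in `ε`. -/
theorem averaged_error (hE : IsLipschitzField E M L K) (hD : IsLipschitzDeriv E D K Q)
    (hε : 0 < ε) (hΔ : 0 < Δt)
    (ht : IsTrajectory E ε x₀ v₀ x v) (hs : IsScheme E ε Δt x₀ v₀ xn vn) (N : ℕ) {T A : ℝ}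
    (hT : T = N * Δt) (hA : A = velocityFactor M L K ε v₀ T) :
    ‖guidingCenter ε (xn N) (vn N) - guidingCenter ε (x T) (v T)‖ ≤
    2 * ((2 * K + T * (Q * (1 + M))) * (ε * A * (2 * ε ^ 2 + Δt)) +
      T * (2 * Q * (ε * A) ^ 2 + Q * (1 + M) * Δt * (ε * A) + (L + K * M) * Δt +
        2 * ε ^ 2 * (K * M))) * Real.exp (2 * K * T) := by
  have hM := hE.bound_nonneg
  have hL := hE.time_nonneg
  have hK := hE.space_nonneg
  have hQ := hD.nonneg
  have hT0 : 0 ≤ T := by rw [hT]; positivity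
  have hA0 : 0 ≤ A := by rw [hA]; exact hE.velocityFactor_nonneg hε hT0
  set y : ℝ → Plane := fun s => guidingCenter ε (x s) (v s) with hy
  set yn : ℕ → Plane := fun n => guidingCenter ε (xn n) (vn n) with hyn
  set u : ℕ → Plane := fun n => ε ^ 3 • v (n * Δt) with hu
  set un : ℕ → Plane := fun n => ε ^ 3 • vn n + (Δt * ε) • perp (vn n) with hun
  set B : ℝ → ℝ := fun t => (2 * K + T * (Q * (1 + M))) * (ε * A * (2 * ε ^ 2 + Δt)) +
      t * (2 * Q * (ε * A) ^ 2 + Q * (1 + M) * Δt * (ε * A) + (L + K * M) * Δt +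
        2 * ε ^ 2 * (K * M)) with hB
  have htime : ∀ n : ℕ, 0 ≤ (n : ℝ) * Δt := fun n => by positivity
  have hsucc : ∀ n : ℕ, (n : ℝ) * Δt ≤ (n + 1 : ℕ) * Δt := fun n => by push_cast; linarith
  have hys : ∀ n : ℕ, ‖y ((n + 1 : ℕ) * Δt) - y (n * Δt)‖ ≤ M * Δt := fun n => by
    have := ht.norm_guidingCenter_sub_le hE hε (htime n) (hsucc n)
    rwa [cast_succ_mul_sub] at this
  have hyns : ∀ n : ℕ, ‖yn (n + 1) - yn n‖ ≤ M * Δt := fun n => by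
    simp only [hyn]
    rw [hs.guidingCenter_succ hε hΔ n, sub_sub_cancel_left, norm_neg, norm_smul, norm_perp,
      Real.norm_of_nonneg hΔ.le, mul_comm]
    exact mul_le_mul_of_nonneg_right (hE.norm_le _ (htime n)) hΔ.le
  have hDs : ∀ (z : ℕ → Plane), (∀ n, ‖z (n + 1) - z n‖ ≤ M * Δt) → ∀ n : ℕ,
      ‖D ((n + 1 : ℕ) * Δt, z (n + 1)) - D (n * Δt, z n)‖ ≤ Q * ((1 + M) * Δt) := by
    intro z hz n
    refine (hD.norm_sub_le _ _ (htime n) (htime (n + 1))).trans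
      (mul_le_mul_of_nonneg_left ?_ hQ)
    rw [cast_succ_mul_sub, abs_of_pos hΔ]
    linarith [hz n]
  have hmain : ∀ n ≤ N, ‖yn n - y (n * Δt)‖ ≤ B T * Real.exp (2 * K * (n * Δt)) +
      K * Δt * ∑ k ∈ Finset.range n, ‖yn k - y (k * Δt)‖ := by
    intro n hn
    have hnT : (n : ℝ) * Δt ≤ T := by
      rw [hT]; exact mul_le_mul_of_nonneg_right (by exact_mod_cast hn) hΔ.le
    set V := A * Real.exp (K * (n * Δt)) with hV
    have hV0 : 0 ≤ V := by positivity
    have hkn : ∀ k ≤ n, (k : ℝ) * Δt ≤ n * Δt := fun k hk =>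
      mul_le_mul_of_nonneg_right (by exact_mod_cast hk) hΔ.le
    have hvV : ∀ s, 0 ≤ s → s ≤ n * Δt → ‖v s‖ ≤ V := fun s h0 h1 => by
      rw [hV, hA]; exact ht.norm_le_of_le hE hε h0 h1 hnT
    have hvnV : ∀ k ≤ n, ‖vn k‖ ≤ V := fun k hk => by
      rw [hV, hA]; exact hs.norm_le_of_le hE hε hΔ (hkn k hk) hnT
    set R := (Q * (ε * V) ^ 2 + Q * ((1 + M) * Δt) * (ε * V) + (L + K * M) * Δt +
      ε ^ 2 * (K * M)) * Δt with hR
    set R' := (Q * (ε * V) ^ 2 + ε ^ 2 * (K * M)) * Δt with hR'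
    set F : ℕ → Plane := fun k => y ((k + 1 : ℕ) * Δt) - y (k * Δt) +
      Δt • perp (E (k * Δt, y (k * Δt))) - perp (D (k * Δt, y (k * Δt)) (u (k + 1) - u k)) with hF
    set F' : ℕ → Plane := fun k => yn (k + 1) - yn k +
      Δt • perp (E (k * Δt, yn k)) - perp (D (k * Δt, yn k) (un (k + 1) - un k)) with hF'
    have hFb : ∀ k ∈ Finset.range n, ‖F k‖ ≤ R := fun k hk => by
      have hk' := Finset.mem_range.1 hk
      have := ht.norm_guidingCenter_expansion_le hE hD hε (htime k) (hsucc k)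
        (fun s hs => hvV s ((htime k).trans hs.1) (hs.2.trans (hkn _ hk')))
      rwa [cast_succ_mul_sub] at this
    have hFb' : ∀ k ∈ Finset.range n, ‖F' k‖ ≤ R' := fun k hk =>
      hs.norm_guidingCenter_expansion_le hE hD hε hΔ k (hvnV k (Finset.mem_range.1 hk).le)
    -- The one-step expansions are telescoped: local remainders, two total-difference sums treated
    -- by summation by parts, and the Lipschitz feedback.
    have hdecomp : yn n - y (n * Δt) =
        ∑ k ∈ Finset.range n, F' k - ∑ k ∈ Finset.range n, F k +
        perp (∑ k ∈ Finset.range n, D (k * Δt, yn k) (un (k + 1) - un k)) -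
        perp (∑ k ∈ Finset.range n, D (k * Δt, y (k * Δt)) (u (k + 1) - u k)) -
        ∑ k ∈ Finset.range n, Δt • perp (E (k * Δt, yn k) - E (k * Δt, y (k * Δt))) := by
      have h0 : yn 0 - y ((0 : ℕ) * Δt) = 0 := by
        simp [hy, hyn, ht.init_x, ht.init_v, hs.init_x, hs.init_v]
      have h1 := Finset.sum_range_sub (fun k : ℕ => yn k - y (k * Δt)) n
      rw [h0, sub_zero] at h1
      rw [← h1, perp_sum, perp_sum, ← Finset.sum_sub_distrib, ← Finset.sum_add_distrib,
        ← Finset.sum_sub_distrib, ← Finset.sum_sub_distrib]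
      refine Finset.sum_congr rfl fun k _ => ?_
      simp only [hF, hF', perp_sub]
      module
    have c1 : ‖∑ k ∈ Finset.range n, F' k‖ ≤ n * R' :=
      (norm_sum_le_of_le _ hFb').trans_eq (by simp)
    have c2 : ‖∑ k ∈ Finset.range n, F k‖ ≤ n * R :=
      (norm_sum_le_of_le _ hFb).trans_eq (by simp)
    have c3 : ‖perp (∑ k ∈ Finset.range n, D (k * Δt, yn k) (un (k + 1) - un k))‖ ≤
        (2 * K + n * (Q * ((1 + M) * Δt))) * ((ε ^ 3 + Δt * ε) * V) := by
      rw [norm_perp]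
      refine norm_sum_apply_sub_le (fun k => D (k * Δt, yn k)) un n
        (fun k => hD.norm_le _ (htime k)) (hDs yn hyns) fun k hk => ?_
      simp only [hun]
      refine (norm_add_le _ _).trans ?_
      rw [norm_smul, norm_smul, norm_perp, Real.norm_of_nonneg (by positivity),
        Real.norm_of_nonneg (by positivity), ← add_mul]
      exact mul_le_mul_of_nonneg_left (hvnV k hk) (by positivity)
    have c4 : ‖perp (∑ k ∈ Finset.range n, D (k * Δt, y (k * Δt)) (u (k + 1) - u k))‖ ≤
        (2 * K + n * (Q * ((1 + M) * Δt))) * (ε ^ 3 * V) := by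
      rw [norm_perp]
      refine norm_sum_apply_sub_le (fun k => D (k * Δt, y (k * Δt))) u n
        (fun k => hD.norm_le _ (htime k)) (hDs (fun k => y (k * Δt)) hys) fun k hk => ?_
      simp only [hu]
      rw [norm_smul, Real.norm_of_nonneg (by positivity)]
      exact mul_le_mul_of_nonneg_left (hvV _ (htime k) (hkn k hk)) (by positivity)
    have c5 : ‖∑ k ∈ Finset.range n, Δt • perp (E (k * Δt, yn k) - E (k * Δt, y (k * Δt)))‖ ≤
        K * Δt * ∑ k ∈ Finset.range n, ‖yn k - y (k * Δt)‖ := by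
      rw [Finset.mul_sum]
      refine norm_sum_le_of_le _ fun k _ => ?_
      rw [norm_smul, norm_perp, Real.norm_of_nonneg hΔ.le]
      have := hE.norm_sub_le (yn k) (y (k * Δt)) (htime k) (htime k)
      rw [sub_self, abs_zero, mul_zero, zero_add] at this
      calc _ ≤ Δt * (K * ‖yn k - y (k * Δt)‖) := mul_le_mul_of_nonneg_left this hΔ.le
        _ = _ := by ring
    have hsum : ‖yn n - y (n * Δt)‖ ≤ n * R' + n * R +
        (2 * K + n * (Q * ((1 + M) * Δt))) * ((ε ^ 3 + Δt * ε) * V) +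
        (2 * K + n * (Q * ((1 + M) * Δt))) * (ε ^ 3 * V) +
        K * Δt * ∑ k ∈ Finset.range n, ‖yn k - y (k * Δt)‖ := by
      rw [hdecomp]
      exact (norm_sub_le _ _).trans (add_le_add ((norm_sub_le _ _).trans (add_le_add
        ((norm_add_le _ _).trans (add_le_add ((norm_sub_le _ _).trans
          (add_le_add c1 c2)) c3)) c4)) c5)
    refine hsum.trans (add_le_add_left ?_ _)
    have hX1 : 1 ≤ Real.exp (2 * K * (n * Δt)) := Real.one_le_exp (by have := htime n; positivity)
    have hVX : V ≤ A * Real.exp (2 * K * (n * Δt)) := by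
      refine mul_le_mul_of_nonneg_left (Real.exp_le_exp.2 ?_) hA0
      linarith [mul_nonneg hK (htime n)]
    -- The quadratic Taylor remainder already uses the whole exponential `e^{2 K t}` allowed; this
    -- is why `discrete_gronwall_sum` is needed at the end.
    have hVX2 : V ^ 2 = A ^ 2 * Real.exp (2 * K * (n * Δt)) := by
      rw [hV, mul_pow, ← Real.exp_nat_mul]
      congr 2
      push_cast
      ring
    set X := Real.exp (2 * K * (n * Δt)) with hX
    have d1 : (2 * K + n * (Q * ((1 + M) * Δt))) * (ε * (2 * ε ^ 2 + Δt) * V) ≤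
        (2 * K + T * (Q * (1 + M))) * (ε * (2 * ε ^ 2 + Δt) * (A * X)) := by
      have : (n : ℝ) * (Q * ((1 + M) * Δt)) ≤ T * (Q * (1 + M)) := by
        calc (n : ℝ) * (Q * ((1 + M) * Δt)) = n * Δt * (Q * (1 + M)) := by ring
          _ ≤ _ := mul_le_mul_of_nonneg_right hnT (by positivity)
      gcongr
    have d2 : (2 * Q * ε ^ 2 * V ^ 2 + Q * (1 + M) * Δt * ε * V + (L + K * M) * Δt +
        2 * ε ^ 2 * (K * M)) ≤ (2 * Q * (ε * A) ^ 2 + Q * (1 + M) * Δt * (ε * A) +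
        (L + K * M) * Δt + 2 * ε ^ 2 * (K * M)) * X := by
      have f1 : Q * (1 + M) * Δt * ε * V ≤ Q * (1 + M) * Δt * ε * (A * X) := by gcongr
      have f2 : (L + K * M) * Δt ≤ (L + K * M) * Δt * X :=
        le_mul_of_one_le_right (by positivity) hX1
      have f3 : 2 * ε ^ 2 * (K * M) ≤ 2 * ε ^ 2 * (K * M) * X :=
        le_mul_of_one_le_right (by positivity) hX1
      rw [hVX2]
      linarith
    have d3 := mul_le_mul hnT d2 (by positivity) hT0
    calc _ = (2 * K + n * (Q * ((1 + M) * Δt))) * (ε * (2 * ε ^ 2 + Δt) * V) +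
          n * Δt * (2 * Q * ε ^ 2 * V ^ 2 + Q * (1 + M) * Δt * ε * V + (L + K * M) * Δt +
        2 * ε ^ 2 * (K * M)) := by rw [hR, hR']; ring
      _ ≤ _ := add_le_add d1 d3
      _ = B T * X := by rw [hB]; ring
  have := discrete_gronwall_sum hK hΔ.le (by positivity) hmain N le_rfl
  rw [← hT] at this
  exact this

end

/-! ### Collecting constants. -/

section

lemma le_add_mul_min {X C₁ C₂ P a b : ℝ} (hC₁ : 0 ≤ C₁) (hC₂ : 0 ≤ C₂) (hP : 0 ≤ P) (ha : 0 ≤ a)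
    (hb : 0 ≤ b) (h₁ : X ≤ C₁ * (P * a)) (h₂ : X ≤ C₂ * (P * b)) :
    X ≤ (C₁ + C₂) * (P * min a b) := by
  rcases min_choice a b with h | h <;> rw [h, add_mul]
  · exact h₁.trans (le_add_of_nonneg_right (by positivity))
  · exact h₂.trans (le_add_of_nonneg_left (by positivity))

variable {E : ℝ × Plane → Plane} {D : ℝ × Plane → Plane →L[ℝ] Plane} {M L K Q ε Δt : ℝ}
  {x₀ v₀ : Plane} {x v : ℝ → Plane} {xn vn : ℕ → Plane}

lemma velocityFactor_le (hE : IsLipschitzField E M L K) (hε : 0 < ε) {T : ℝ} (hT : 0 ≤ T) :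
    velocityFactor M L K ε v₀ T ≤ (1 + 2 * M + L + K * M) * (1 + T) * (‖v₀‖ + ε) := by
  have hM := hE.bound_nonneg
  have hL := hE.time_nonneg
  have hKM := mul_nonneg hE.space_nonneg hM
  have hr := norm_nonneg v₀
  unfold velocityFactor
  have h1 : 1 ≤ (1 + 2 * M + L + K * M) * (1 + T) :=
    one_le_mul_of_one_le_of_one_le (by linarith) (by linarith)
  have h2 : 2 * M + (L + K * M) * T ≤ (1 + 2 * M + L + K * M) * (1 + T) := by
    have : 0 ≤ (1 + 2 * M) * T := by positivity
    linarith
  calc _ ≤ (1 + 2 * M + L + K * M) * (1 + T) * ‖v₀‖ +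
        ε * ((1 + 2 * M + L + K * M) * (1 + T)) :=
        add_le_add (le_mul_of_one_le_left hr h1) (mul_le_mul_of_nonneg_left h2 hε.le)
    _ = _ := by ring

lemma classical_factor_le (hM : 0 ≤ M) (hL : 0 ≤ L) (hK : 0 ≤ K) (hε : 0 < ε) {T A c r : ℝ}
    (hT : 0 ≤ T) (hr : 0 ≤ r) (hc : 0 ≤ c) (hA : A ≤ c * (1 + T) * (r + ε)) :
    2 * L + 2 * K * A / ε + M / ε ^ 2 + A / ε ^ 3 ≤
      (2 * L + 2 * K * c + M + c) * ((1 + T) * ((1 + r + ε) * (1 + ε ^ 2))) / ε ^ 3 := by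
  rw [le_div_iff₀ (by positivity)]
  -- The factors `1` pad every term to the same product shape, so that the bounds below apply factor
  -- by factor.
  have e : (2 * L + 2 * K * A / ε + M / ε ^ 2 + A / ε ^ 3) * ε ^ 3 =
      2 * L * (1 * (ε * ε ^ 2)) + 2 * K * (A * ε ^ 2) + M * (1 * (ε * 1)) + A * 1 := by
    field_simp
  have hA' : A ≤ c * (1 + T) * (1 + r + ε) := hA.trans (by gcongr; linarith)
  have hT1 : 1 ≤ 1 + T := by linarith
  have hP : ε ≤ 1 + r + ε := by linarith
  have hW : ε ^ 2 ≤ 1 + ε ^ 2 := by linarith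
  have hW1 : 1 ≤ 1 + ε ^ 2 := by linarith [sq_nonneg ε]
  rw [e]
  calc _ ≤ 2 * L * ((1 + T) * ((1 + r + ε) * (1 + ε ^ 2))) +
        2 * K * (c * (1 + T) * (1 + r + ε) * (1 + ε ^ 2)) +
        M * ((1 + T) * ((1 + r + ε) * (1 + ε ^ 2))) +
        c * (1 + T) * (1 + r + ε) * (1 + ε ^ 2) := by gcongr
    _ = _ := by ring

lemma mul_one_add_le (T : ℝ) : T * (1 + T) ≤ 2 * (1 + T ^ 2) := by
  nlinarith [sq_nonneg (T - 1)]

lemma one_add_sq_le (T : ℝ) : (1 + T) ^ 2 ≤ 2 * (1 + T ^ 2) := by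
  nlinarith [sq_nonneg (T - 1)]

lemma one_add_pow_four_le (T : ℝ) : (1 + T) ^ 4 ≤ 8 * (1 + T ^ 4) := by
  nlinarith [sq_nonneg (T - 1), sq_nonneg (T ^ 2 - 1), one_add_sq_le T, sq_nonneg (1 + T),
    sq_nonneg T, sq_nonneg ((1 + T) ^ 2)]

/-- The classical estimate with all constants collected. -/
lemma classical_error_le (hE : IsLipschitzField E M L K) (hε : 0 < ε) (hΔ : 0 < Δt)
    (ht : IsTrajectory E ε x₀ v₀ x v) (hs : IsScheme E ε Δt x₀ v₀ xn vn) (N : ℕ) :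
    ‖guidingCenter ε (xn N) (vn N) - guidingCenter ε (x (N * Δt)) (v (N * Δt))‖ +
      ε * ‖vn N - v (N * Δt)‖ ≤
    (2 * L + 2 * K * (1 + 2 * M + L + K * M) + M + (1 + 2 * M + L + K * M)) *
      ((N * Δt * (1 + N * Δt)) * Real.exp (2 * K * (N * Δt)) *
        ((1 + ‖v₀‖ + ε) * (1 + ε ^ 2)) * (Δt / ε ^ 3)) := by
  have hM := hE.bound_nonneg
  have hL := hE.time_nonneg
  have hK := hE.space_nonneg
  have hT : 0 ≤ (N : ℝ) * Δt := by positivity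
  refine (classical_error hE hε hΔ ht hs N).trans ?_
  have h := classical_factor_le hM hL hK hε hT (norm_nonneg v₀) (by positivity)
    (velocityFactor_le (v₀ := v₀) hE hε hT)
  calc _ ≤ N * Δt * (Δt * ((2 * L + 2 * K * (1 + 2 * M + L + K * M) + M +
        (1 + 2 * M + L + K * M)) * ((1 + N * Δt) * ((1 + ‖v₀‖ + ε) * (1 + ε ^ 2))) / ε ^ 3)) *
        Real.exp (2 * K * (N * Δt)) := by gcongr
    _ = _ := by ring

theorem exists_position_error (hE : IsLipschitzField E M L K) :
    ∃ C : ℝ, ∀ ε Δt : ℝ, 0 < ε → 0 < Δt → ∀ x₀ v₀ : Plane,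
      ∀ x v : ℝ → Plane, IsTrajectory E ε x₀ v₀ x v →
      ∀ xn vn : ℕ → Plane, IsScheme E ε Δt x₀ v₀ xn vn →
      ∀ n : ℕ, ‖xn n - x (n * Δt)‖ ≤
        C * ((1 + (n * Δt) ^ 2) * Real.exp (2 * K * (n * Δt)) * (1 + ‖v₀‖ + ε) *
          min (Δt / ε ^ 3 * (1 + ε ^ 2)) (Δt + ε)) := by
  have hM := hE.bound_nonneg
  have hL := hE.time_nonneg
  have hK := hE.space_nonneg
  obtain ⟨c, hc⟩ : ∃ c, c = 1 + 2 * M + L + K * M := ⟨_, rfl⟩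
  have hc0 : 0 ≤ c := by rw [hc]; positivity
  refine ⟨(2 * L + 2 * K * c + M + c) * 2 + (L + K * M + 2 * K * c + 2 * c) * 2,
    fun ε Δt hε hΔ x₀ v₀ x v ht xn vn hs n => ?_⟩
  have hT : 0 ≤ (n : ℝ) * Δt := by positivity
  have hx := norm_sub_le_guidingCenter hε (xn n) (x (n * Δt)) (vn n) (v (n * Δt))
  refine le_add_mul_min (by positivity) (by positivity) (by positivity) (by positivity)
    (by positivity) ?_ ?_
  · refine (hx.trans (classical_error_le hE hε hΔ ht hs n)).trans ?_
    rw [← hc]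
    have := mul_one_add_le (n * Δt)
    calc _ ≤ (2 * L + 2 * K * c + M + c) *
          ((2 * (1 + (n * Δt) ^ 2)) * Real.exp (2 * K * (n * Δt)) *
        ((1 + ‖v₀‖ + ε) * (1 + ε ^ 2)) * (Δt / ε ^ 3)) := by gcongr
      _ = _ := by ring
  -- The uniform branch adds to the guiding center error the term `ε ‖vn - v‖`, estimated by the two
  -- velocity bounds alone.
  · have hA := velocityFactor_le (v₀ := v₀) hE hε hT
    rw [← hc] at hA
    have h1 := drift_error hE hε hΔ ht hs n
    have h2 := ht.norm_le hE hε hT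
    have h3 := hs.norm_le hE hε hΔ n
    have hA0 := hE.velocityFactor_nonneg (v₀ := v₀) hε hT
    set A := velocityFactor M L K ε v₀ (n * Δt) with hA_def
    set T := (n : ℝ) * Δt with hT_def
    set X := Real.exp (2 * K * T) with hX
    have hexp : Real.exp (K * T) ≤ X :=
      Real.exp_le_exp.2 (by linarith [mul_nonneg hK hT])
    have h4 : ε * ‖vn n - v T‖ ≤ ε * (2 * (A * X)) := by
      refine mul_le_mul_of_nonneg_left ((norm_sub_le _ _).trans ?_) hε.le
      have := mul_le_mul_of_nonneg_left hexp hA0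
      linarith
    set P := 1 + ‖v₀‖ + ε with hP
    have hP1 : 1 ≤ P := by have := norm_nonneg v₀; linarith
    have hT1 : T ≤ 1 + T := by linarith
    have hT1' : 1 ≤ 1 + T := by linarith
    have hZ1 : Δt ≤ Δt + ε := by linarith
    have hZ2 : ε ≤ Δt + ε := by linarith
    have hA' : A ≤ c * (1 + T) * P := hA.trans (by gcongr; linarith)
    calc _ ≤ T * ((L + K * M) * Δt + 2 * ε * K * A) * X + ε * (2 * (A * X)) :=
          hx.trans (add_le_add h1 h4)
      _ = ((L + K * M) * (T * 1 * 1 * Δt) + 2 * K * (T * A * ε) + 2 * (1 * A * ε)) * X := by ring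
      _ ≤ ((L + K * M) * ((1 + T) * (1 + T) * P * (Δt + ε)) +
          2 * K * ((1 + T) * (c * (1 + T) * P) * (Δt + ε)) +
          2 * ((1 + T) * (c * (1 + T) * P) * (Δt + ε))) * X := by gcongr
      _ = (L + K * M + 2 * K * c + 2 * c) * ((1 + T) ^ 2 * X * P * (Δt + ε)) := by ring
      _ ≤ (L + K * M + 2 * K * c + 2 * c) * (2 * (1 + T ^ 2) * X * P * (Δt + ε)) := by
          have := one_add_sq_le T
          gcongr
      _ = _ := by ring

theorem exists_guidingCenter_error (hE : IsLipschitzField E M L K)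
    (hD : IsLipschitzDeriv E D K Q) :
    ∃ C : ℝ, ∀ ε Δt : ℝ, 0 < ε → 0 < Δt → ∀ x₀ v₀ : Plane,
      ∀ x v : ℝ → Plane, IsTrajectory E ε x₀ v₀ x v →
      ∀ xn vn : ℕ → Plane, IsScheme E ε Δt x₀ v₀ xn vn →
      ∀ n : ℕ, ‖guidingCenter ε (xn n) (vn n) - guidingCenter ε (x (n * Δt)) (v (n * Δt))‖ ≤
        C * ((1 + (n * Δt) ^ 4) * Real.exp (2 * K * (n * Δt)) * (1 + ‖v₀‖ ^ 2 + ε ^ 2) *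
          min (Δt / ε ^ 3 * (1 + ε)) (Δt + ε ^ 2)) := by
  have hM := hE.bound_nonneg
  have hL := hE.time_nonneg
  have hK := hE.space_nonneg
  have hQ := hD.nonneg
  obtain ⟨c, hc⟩ : ∃ c, c = 1 + 2 * M + L + K * M := ⟨_, rfl⟩
  have hc0 : 0 ≤ c := by rw [hc]; positivity
  set c₂ := 2 * (4 * c * (2 * K + Q * (1 + M)) + 4 * Q * c ^ 2 + 2 * c * (Q * (1 + M)) +
    (L + K * M) + 2 * (K * M)) with hc₂
  refine ⟨(2 * L + 2 * K * c + M + c) * 16 + c₂ * 8,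
    fun ε Δt hε hΔ x₀ v₀ x v ht xn vn hs n => ?_⟩
  have hT : 0 ≤ (n : ℝ) * Δt := by positivity
  refine le_add_mul_min (by positivity) (by positivity) (by positivity) (by positivity)
    (by positivity) ?_ ?_
  · refine (le_add_of_nonneg_right (by positivity)).trans
      ((classical_error_le hE hε hΔ ht hs n).trans ?_)
    rw [← hc]
    set T := (n : ℝ) * Δt with hT_def
    have h1 : T * (1 + T) ≤ 8 * (1 + T ^ 4) := by
      refine le_trans ?_ (one_add_pow_four_le T)
      calc T * (1 + T) ≤ (1 + T) * (1 + T) := by gcongr; linarith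
        _ = (1 + T) ^ 2 := by ring
        _ ≤ _ := pow_le_pow_right₀ (by linarith) (by norm_num)
    -- The classical estimate is reused as it is: one power of `ε` moves from the factor `1 + ε ^ 2`
    -- into the quadratic prefactor.
    have h2 : (1 + ‖v₀‖ + ε) * (1 + ε ^ 2) ≤ 2 * ((1 + ‖v₀‖ ^ 2 + ε ^ 2) * (1 + ε)) := by
      have a1 : ‖v₀‖ ≤ 1 + ‖v₀‖ ^ 2 := by nlinarith [sq_nonneg (‖v₀‖ - 1)]
      have a2 : ‖v₀‖ * ε ≤ ‖v₀‖ ^ 2 + ε ^ 2 := by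
        nlinarith [sq_nonneg (‖v₀‖ - ε), sq_nonneg ‖v₀‖, sq_nonneg ε]
      have a3 := mul_le_mul_of_nonneg_right a2 hε.le
      have a4 : 0 ≤ ‖v₀‖ ^ 2 * ε := by positivity
      have a5 : 0 ≤ ε ^ 3 := by positivity
      nlinarith [sq_nonneg ‖v₀‖, sq_nonneg ε]
    calc _ ≤ (2 * L + 2 * K * c + M + c) * ((8 * (1 + T ^ 4)) * Real.exp (2 * K * T) *
          (2 * ((1 + ‖v₀‖ ^ 2 + ε ^ 2) * (1 + ε))) * (Δt / ε ^ 3)) := by gcongr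
      _ = _ := by ring
  · have hA := velocityFactor_le (v₀ := v₀) hE hε hT
    rw [← hc] at hA
    have h1 := averaged_error hE hD hε hΔ ht hs n rfl rfl
    have hA0 := hE.velocityFactor_nonneg (v₀ := v₀) hε hT
    set A := velocityFactor M L K ε v₀ (n * Δt) with hA_def
    set T := (n : ℝ) * Δt with hT_def
    set X := Real.exp (2 * K * T) with hX
    set P := 1 + ‖v₀‖ ^ 2 + ε ^ 2 with hP
    have hP1 : 1 ≤ P := by have := sq_nonneg ‖v₀‖; have := sq_nonneg ε; linarith
    have hT1 : T ≤ 1 + T := by linarith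
    have hT1' : 1 ≤ 1 + T := by linarith
    have hZ1 : Δt ≤ Δt + ε ^ 2 := by linarith [sq_nonneg ε]
    have hZ2 : ε ^ 2 ≤ Δt + ε ^ 2 := by linarith
    -- Here and for `A ^ 2` the velocity factor occurs in products of degree two in `(‖v₀‖, ε)`,
    -- whence the quadratic prefactor `P`.
    have hεA : ε * A ≤ 2 * c * (1 + T) * P := by
      calc ε * A ≤ ε * (c * (1 + T) * (‖v₀‖ + ε)) := by gcongr
        _ = c * (1 + T) * (ε * (‖v₀‖ + ε)) := by ring
        _ ≤ c * (1 + T) * (2 * P) := by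
            refine mul_le_mul_of_nonneg_left ?_ (by positivity)
            nlinarith [sq_nonneg (‖v₀‖ - ε), sq_nonneg ‖v₀‖, sq_nonneg ε]
        _ = _ := by ring
    have hA2 : A ^ 2 ≤ 2 * c ^ 2 * (1 + T) ^ 2 * P := by
      calc A ^ 2 ≤ (c * (1 + T) * (‖v₀‖ + ε)) ^ 2 := by gcongr
        _ = c ^ 2 * (1 + T) ^ 2 * (‖v₀‖ + ε) ^ 2 := by ring
        _ ≤ c ^ 2 * (1 + T) ^ 2 * (2 * P) := by
            gcongr
            nlinarith [sq_nonneg (‖v₀‖ - ε)]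
        _ = _ := by ring
    have b1 : (2 * K + T * (Q * (1 + M))) * (ε * A * (2 * ε ^ 2 + Δt)) ≤
        4 * c * (2 * K + Q * (1 + M)) * ((1 + T) ^ 4 * P * (Δt + ε ^ 2)) := by
      have a1 : 2 * K + T * (Q * (1 + M)) ≤ (2 * K + Q * (1 + M)) * (1 + T) := by
        have : 0 ≤ 2 * K * T + Q * (1 + M) := by positivity
        linarith
      have a2 : 2 * ε ^ 2 + Δt ≤ 2 * (Δt + ε ^ 2) := by linarith
      calc _ ≤ (2 * K + Q * (1 + M)) * (1 + T) *
            (2 * c * (1 + T) * P * (2 * (Δt + ε ^ 2))) := by gcongr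
        _ = 4 * c * (2 * K + Q * (1 + M)) * ((1 + T) ^ 2 * P * (Δt + ε ^ 2)) := by ring
        _ ≤ _ := by gcongr; norm_num
    have b2 : T * (2 * Q * (ε * A) ^ 2) ≤ 4 * Q * c ^ 2 * ((1 + T) ^ 4 * P * (Δt + ε ^ 2)) := by
      calc _ = 2 * Q * (T * A ^ 2 * ε ^ 2) := by ring
        _ ≤ 2 * Q * ((1 + T) * (2 * c ^ 2 * (1 + T) ^ 2 * P) * (Δt + ε ^ 2)) := by gcongr
        _ = 4 * Q * c ^ 2 * ((1 + T) ^ 3 * P * (Δt + ε ^ 2)) := by ring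
        _ ≤ _ := by gcongr; norm_num
    have b3 : T * (Q * (1 + M) * Δt * (ε * A)) ≤
        2 * c * (Q * (1 + M)) * ((1 + T) ^ 4 * P * (Δt + ε ^ 2)) := by
      calc _ ≤ (1 + T) * (Q * (1 + M) * (Δt + ε ^ 2) * (2 * c * (1 + T) * P)) := by gcongr
        _ = 2 * c * (Q * (1 + M)) * ((1 + T) ^ 2 * P * (Δt + ε ^ 2)) := by ring
        _ ≤ _ := by gcongr; norm_num
    have hTP : T * 1 ≤ (1 + T) ^ 4 * P := by
      have : (1 + T) ^ 1 ≤ (1 + T) ^ 4 := pow_le_pow_right₀ hT1' (by norm_num)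
      rw [pow_one] at this
      exact mul_le_mul (hT1.trans this) hP1 zero_le_one (by positivity)
    have b4 : T * ((L + K * M) * Δt) ≤ (L + K * M) * ((1 + T) ^ 4 * P * (Δt + ε ^ 2)) := by
      calc _ = (L + K * M) * (T * 1 * Δt) := by ring
        _ ≤ _ := by gcongr
    have b5 : T * (2 * ε ^ 2 * (K * M)) ≤
        2 * (K * M) * ((1 + T) ^ 4 * P * (Δt + ε ^ 2)) := by
      calc _ = 2 * (K * M) * (T * 1 * ε ^ 2) := by ring
        _ ≤ _ := by gcongr
    calc _ ≤ _ := h1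
      _ = 2 * ((2 * K + T * (Q * (1 + M))) * (ε * A * (2 * ε ^ 2 + Δt)) +
          T * (2 * Q * (ε * A) ^ 2) + T * (Q * (1 + M) * Δt * (ε * A)) +
          T * ((L + K * M) * Δt) + T * (2 * ε ^ 2 * (K * M))) * X := by ring
      _ ≤ 2 * (4 * c * (2 * K + Q * (1 + M)) * ((1 + T) ^ 4 * P * (Δt + ε ^ 2)) +
          4 * Q * c ^ 2 * ((1 + T) ^ 4 * P * (Δt + ε ^ 2)) +
          2 * c * (Q * (1 + M)) * ((1 + T) ^ 4 * P * (Δt + ε ^ 2)) +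
          (L + K * M) * ((1 + T) ^ 4 * P * (Δt + ε ^ 2)) +
          2 * (K * M) * ((1 + T) ^ 4 * P * (Δt + ε ^ 2))) * X := by gcongr
      _ = c₂ * ((1 + T) ^ 4 * X * P * (Δt + ε ^ 2)) := by rw [hc₂]; ring
      _ ≤ c₂ * (8 * (1 + T ^ 4) * X * P * (Δt + ε ^ 2)) := by
          have := one_add_pow_four_le T
          gcongr
      _ = _ := by ring

end

end Particle

end

theorem theorem3p1 :
    -- the scheme has a unique solution
    (∀ (E : ℝ × Particle.Plane → Particle.Plane) (ε Δt : ℝ), 0 < ε → 0 < Δt →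
      ∀ x₀ v₀ : Particle.Plane,
        ∃! s : (ℕ → Particle.Plane) × (ℕ → Particle.Plane),
          Particle.IsScheme E ε Δt x₀ v₀ s.1 s.2) ∧
    -- (i) error in the space variable
    (∀ E : ℝ × Particle.Plane → Particle.Plane,
      ContinuousOn E (Set.Ici 0 ×ˢ Set.univ) →
      Sobolev.MemW1Inf Particle.spaceTime E →
      ∃ C : ℝ, ∀ ε Δt : ℝ, 0 < ε → 0 < Δt → ∀ x₀ v₀ : Particle.Plane,
        ∀ x v : ℝ → Particle.Plane, Particle.IsTrajectory E ε x₀ v₀ x v →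
        ∀ xn vn : ℕ → Particle.Plane, Particle.IsScheme E ε Δt x₀ v₀ xn vn →
        ∀ n : ℕ,
          ‖xn n - x (n * Δt)‖ ≤
            C * ((1 + (n * Δt) ^ 2) * Real.exp (2 * Particle.Kx E * (n * Δt)) *
              (1 + ‖v₀‖ + ε) *
              min (Δt / ε ^ 3 * (1 + ε ^ 2)) (Δt + ε))) ∧
    -- (ii) error in the guiding-center variable
    (∀ E : ℝ × Particle.Plane → Particle.Plane,
      ContinuousOn E (Set.Ici 0 ×ˢ Set.univ) →
      Sobolev.MemW2Inf Particle.spaceTime E →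
      ∃ C : ℝ, ∀ ε Δt : ℝ, 0 < ε → 0 < Δt → ∀ x₀ v₀ : Particle.Plane,
        ∀ x v : ℝ → Particle.Plane, Particle.IsTrajectory E ε x₀ v₀ x v →
        ∀ xn vn : ℕ → Particle.Plane, Particle.IsScheme E ε Δt x₀ v₀ xn vn →
        ∀ n : ℕ,
          ‖Particle.guidingCenter ε (xn n) (vn n) -
              Particle.guidingCenter ε (x (n * Δt)) (v (n * Δt))‖ ≤
            C * ((1 + (n * Δt) ^ 4) * Real.exp (2 * Particle.Kx E * (n * Δt)) *
              (1 + ‖v₀‖ ^ 2 + ε ^ 2) *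
              min (Δt / ε ^ 3 * (1 + ε)) (Δt + ε ^ 2))) := by
  refine ⟨fun E ε Δt hε hΔ x₀ v₀ => Particle.existsUnique_isScheme E hε hΔ x₀ v₀,
    fun E hc hW => ?_, fun E hc hW => ?_⟩
  · obtain ⟨M, L, hE⟩ := Particle.isLipschitzField_of_memW1Inf hc hW
    exact Particle.exists_position_error hE
  · obtain ⟨M, L, hE⟩ := Particle.isLipschitzField_of_memW2Inf hc hW
    obtain ⟨D, Q, hD⟩ := Particle.exists_isLipschitzDeriv_of_memW2Inf hc hW
    exact Particle.exists_guidingCenter_error hE hD
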